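/- Let $(\mathcal M,g)$ be a smooth 4-dimensional manifold with a smooth metric of signature $(-1,1,1,1)$, and let $\mathcal F=\{\mathcal F_a\}$ be a smooth foliation of $\mathcal M$ by 2-dimensional leaves that is null, i.e. the restriction of $g$ to the tangent spaces of the leaves is degenerate. Let $p\in\mathcal M$ and let $(U,(x^1,\dots,x^4))$ be an adapted chart centered at $p$: a smooth chart whose slices $\{x^3=c,\ x^4=d\}$ are connected and such that every leaf meets $U$ in an at most countable union of such slices. Let $(s,l,\alpha^\sharp,n)$ be a null foliation adapted frame on $U$: smooth vector fields on $U$ such that $s,l$ span the tangent spaces of the leaves and, with $\alpha=g(\alpha^\sharp,\cdot)$, $$g(s,s)=g(\alpha^\sharp,\alpha^\sharp)=1,\qquad g(n,l)=-1,$$ all other scalar products of two members of the frame being $0$. Write $X^\flat=g(X,\cdot)$ and put $\kappa=(\alpha_3\,l^\flat_4-\alpha_4\,l^\flat_3)^{-1}$, where $\alpha=\alpha_3dx^3+\alpha_4dx^4$ and $l^\flat=l^\flat_3dx^3+l^\flat_4dx^4$. A smooth 2-form $F$ on $U$ is called a null force-free field if $dF=0$, $F(j^\sharp,\cdot)=0$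 with $j=*d*F$, and $F_{\mu\nu}F^{\mu\nu}=0$; it is called a solution for $\mathcal F$ if, in addition, its kernel at each $q\in U$ is exactly the tangent space at $q$ of the leaf through $q$. A leaf function is a smooth function $u=u(x^3,x^4)$ on $U$, i.e. a smooth function that is constant on each slice $\{x^3=c,\ x^4=d\}$; put $F_u=(u\kappa)\,\alpha\wedge l^\flat$. Consider the conditions, on all of $U$, $$d\alpha(l,\alpha^\sharp)=ds^\flat(l,s),\qquad dl^\flat(l,\alpha^\sharp)=0.\tag{C}$$ Then: 1. For every nowhere vanishing leaf function $u$, $F_u$ is a solution for $\mathcal F$ if and only if (C) holds. 2. If (C) holds, then for every leaf function $u$ (possibly with zeros) $F_u$ is a null force-free field, and at $q\in U$ its kernel is exactly the tangent space of the leaf through $q$ if and only if $u(q)\neq0$. 3. The solutions for $\mathcal F$ are exactly the forms $F_u$ with $u$ a nowhere vanishing leaf function if and only if (C) holds. -/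

import Mathlib

open scoped Manifold ContDiff Topology

noncomputable section

namespace NullFF

/-- The model space `ℝ⁴`. The coordinates `x¹, x², x³, x⁴` are those of index `0, 1, 2, 3`. -/
abbrev E4 : Type := EuclideanSpace ℝ (Fin 4)

variable {M : Type*} [TopologicalSpace M] [ChartedSpace E4 M]

/-! ### Lorentzian metrics -/

/-- A smooth metric of signature `(-1, 1, 1, 1)` on a 4-manifold. -/
structure LorentzMetric (M : Type*) [TopologicalSpace M] [ChartedSpace E4 M]
    [IsManifold 𝓘(ℝ, E4) ∞ M] where
  /-- the scalar product on each tangent space -/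
  inner (q : M) : TangentSpace 𝓘(ℝ, E4) q →L[ℝ] TangentSpace 𝓘(ℝ, E4) q →L[ℝ] ℝ
  symm (q : M) (v w : TangentSpace 𝓘(ℝ, E4) q) : inner q v w = inner q w v
  signature (q : M) : ∃ b : Module.Basis (Fin 4) ℝ (TangentSpace 𝓘(ℝ, E4) q),
    ∀ i j, inner q (b i) (b j) = if i = j then (if i = 0 then -1 else 1) else 0
  contMDiff : ContMDiff 𝓘(ℝ, E4) (𝓘(ℝ, E4).prod 𝓘(ℝ, E4 →L[ℝ] E4 →L[ℝ] ℝ)) ∞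
    (fun q ↦ Bundle.TotalSpace.mk' (E4 →L[ℝ] E4 →L[ℝ] ℝ)
      (E := fun x : M ↦ TangentSpace 𝓘(ℝ, E4) x →L[ℝ] TangentSpace 𝓘(ℝ, E4) x →L[ℝ] ℝ)
      q (inner q))

/-! ### Foliations by surfaces -/

/-- `e` is a flat chart for the partition `leaves`: it is a smooth chart whose slices
`{x³ = c, x⁴ = d}` are connected, and each leaf meets the domain of the chart in an (at most)
countable union of such slices. -/
structure IsFlatChart (leaves : Set (Set M)) (e : OpenPartialHomeomorph M E4) : Prop where
  mem_maximalAtlas : e ∈ IsManifold.maximalAtlas 𝓘(ℝ, E4) ∞ M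
  slice_connected : ∀ c d : ℝ, IsPreconnected {y ∈ e.target | y 2 = c ∧ y 3 = d}
  leaf_inter : ∀ L ∈ leaves, ∃ C : Set (ℝ × ℝ), C.Countable ∧
    L ∩ e.source = {q ∈ e.source | ((e q) 2, (e q) 3) ∈ C}

/-- A smooth foliation of a 4-manifold by 2-dimensional leaves: a partition into connected
subsets (the leaves) such that there is a flat chart about every point. (A path in `M` that stays
in a leaf stays, locally, in a single slice, so that path-connectedness in `M` is the same as
connectedness of the leaf as an immersed surface.) -/
structure Foliation (M : Type*) [TopologicalSpace M] [ChartedSpace E4 M] where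
  /-- the set of all leaves -/
  leaves : Set (Set M)
  isPartition : Setoid.IsPartition leaves
  isPathConnected : ∀ L ∈ leaves, IsPathConnected L
  exists_flatChart : ∀ q : M, ∃ e : OpenPartialHomeomorph M E4, q ∈ e.source ∧
    IsFlatChart leaves e

/-- The tangent space at `q` of the leaf through `q`: all velocities at `q` of smooth curves
that stay in the leaf. -/
def Foliation.tangent (𝓕 : Foliation M) (q : M) : Set (TangentSpace 𝓘(ℝ, E4) q) :=
  {v | ∃ L ∈ 𝓕.leaves, ∃ γ : ℝ → M, ContMDiffAt 𝓘(ℝ, ℝ) 𝓘(ℝ, E4) ∞ γ 0 ∧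
    (∀ᶠ t in 𝓝 (0 : ℝ), γ t ∈ L) ∧
    tangentMap 𝓘(ℝ, ℝ) 𝓘(ℝ, E4) γ ⟨0, (1 : ℝ)⟩ = ⟨q, v⟩}

/-- A null foliation: the metric is degenerate on the tangent spaces of the leaves. -/
def Foliation.IsNull [IsManifold 𝓘(ℝ, E4) ∞ M] (𝓕 : Foliation M) (g : LorentzMetric M) : Prop :=
  ∀ q : M, ∃ v ∈ 𝓕.tangent q, v ≠ 0 ∧ ∀ w ∈ 𝓕.tangent q, g.inner q v w = 0

/-- A foliation adapted chart centered at `p`. -/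
structure Foliation.IsAdaptedChart (𝓕 : Foliation M) (p : M)
    (e : OpenPartialHomeomorph M E4) : Prop where
  isFlatChart : IsFlatChart 𝓕.leaves e
  mem_source : p ∈ e.source
  centered : e p = 0

/-! ### Differential forms on the domain of a chart -/

/-- The coordinate vector field `∂_i` of the chart `e`. -/
def coordVec (e : OpenPartialHomeomorph M E4) (i : Fin 4) (q : M) : TangentSpace 𝓘(ℝ, E4) q :=
  mfderiv 𝓘(ℝ, E4) 𝓘(ℝ, E4) e.symm (e q) (EuclideanSpace.single i (1 : ℝ))

/-- The coordinate differential `dxⁱ` of the chart `e`. -/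
def coordForm (e : OpenPartialHomeomorph M E4) (i : Fin 4) (q : M) :
    TangentSpace 𝓘(ℝ, E4) q →L[ℝ] ℝ :=
  (EuclideanSpace.proj i : E4 →L[ℝ] ℝ).comp
    (mfderiv 𝓘(ℝ, E4) 𝓘(ℝ, E4) e q : TangentSpace 𝓘(ℝ, E4) q →L[ℝ] E4)

/-- (Not necessarily smooth) differential `k`-forms. -/
abbrev Form (M : Type*) [TopologicalSpace M] [ChartedSpace E4 M] (k : ℕ) : Type _ :=
  (q : M) → (TangentSpace 𝓘(ℝ, E4) q) [⋀^Fin k]→L[ℝ] ℝ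

/-- The wedge product `θ₁ ∧ ⋯ ∧ θₖ` of covectors:
`(θ₁ ∧ ⋯ ∧ θₖ)(v₁, …, vₖ) = det (θᵢ(vⱼ))`. -/
def wedge {V : Type*} [AddCommGroup V] [Module ℝ V] [TopologicalSpace V] [IsTopologicalAddGroup V]
    [ContinuousSMul ℝ V] {k : ℕ} (θ : Fin k → (V →L[ℝ] ℝ)) : V [⋀^Fin k]→L[ℝ] ℝ :=
  ContinuousMultilinearMap.alternatization
    ((ContinuousMultilinearMap.mkPiAlgebra ℝ (Fin k) ℝ).compContinuousLinearMap θ)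

/-- The form `η` expressed in the coordinates of the chart `e`, a form on `e.target ⊆ ℝ⁴`. -/
def coordRep (e : OpenPartialHomeomorph M E4) {k : ℕ} (η : Form M k) (y : E4) :
    E4 [⋀^Fin k]→L[ℝ] ℝ :=
  (η (e.symm y)).compContinuousLinearMap
    (mfderiv 𝓘(ℝ, E4) 𝓘(ℝ, E4) e.symm y : E4 →L[ℝ] TangentSpace 𝓘(ℝ, E4) (e.symm y))

/-- `η` is smooth on the domain of the chart `e`. -/
def IsSmoothForm (e : OpenPartialHomeomorph M E4) {k : ℕ} (η : Form M k) : Prop :=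
  ContDiffOn ℝ ∞ (coordRep e η) e.target

/-- The exterior derivative `dη` on the domain of the chart `e`, computed in the coordinates of
`e`; see `extD_eq_of_charts` for the independence of the chart. -/
def extD (e : OpenPartialHomeomorph M E4) {k : ℕ} (η : Form M k) : Form M (k + 1) := fun q ↦
  (extDeriv (coordRep e η) (e q)).compContinuousLinearMap
    (mfderiv 𝓘(ℝ, E4) 𝓘(ℝ, E4) e q : TangentSpace 𝓘(ℝ, E4) q →L[ℝ] E4)

/-- The exterior derivative does not depend on the chart in which it is computed. -/
theorem extD_eq_of_charts [IsManifold 𝓘(ℝ, E4) ∞ M] {e e' : OpenPartialHomeomorph M E4}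
    (he : e ∈ IsManifold.maximalAtlas 𝓘(ℝ, E4) ∞ M)
    (he' : e' ∈ IsManifold.maximalAtlas 𝓘(ℝ, E4) ∞ M) {k : ℕ} (η : Form M k) {q : M}
    (hq : q ∈ e.source) (hq' : q ∈ e'.source) (hη : DifferentiableAt ℝ (coordRep e η) (e q)) :
    extD e η q = extD e' η q := by
  have hes : ∀ x ∈ e.source, MDifferentiableAt 𝓘(ℝ, E4) 𝓘(ℝ, E4) e x := fun x hx ↦
    (contMDiffAt_of_mem_maximalAtlas he hx).mdifferentiableAt (by simp)
  have hes' : ∀ x ∈ e'.source, MDifferentiableAt 𝓘(ℝ, E4) 𝓘(ℝ, E4) e' x := fun x hx ↦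
    (contMDiffAt_of_mem_maximalAtlas he' hx).mdifferentiableAt (by simp)
  have het : ∀ y ∈ e.target, MDifferentiableAt 𝓘(ℝ, E4) 𝓘(ℝ, E4) e.symm y := fun y hy ↦
    ((contMDiffOn_symm_of_mem_maximalAtlas he).contMDiffAt
      (e.open_target.mem_nhds hy)).mdifferentiableAt (by simp)
  have het' : ∀ y ∈ e'.target, MDifferentiableAt 𝓘(ℝ, E4) 𝓘(ℝ, E4) e'.symm y := fun y hy ↦
    ((contMDiffOn_symm_of_mem_maximalAtlas he').contMDiffAt
      (e'.open_target.mem_nhds hy)).mdifferentiableAt (by simp)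
  set φ : E4 → E4 := fun y ↦ e (e'.symm y) with hφ
  have hU : {y | y ∈ e'.target ∧ e'.symm y ∈ e.source} ∈ 𝓝 (e' q) :=
    (e'.symm.isOpen_inter_preimage e.open_source).mem_nhds
      ⟨e'.map_source hq', by simpa [hq'] using hq⟩
  have hφq : φ (e' q) = e q := by simp [hφ, hq']
  have hφd : ContDiffAt ℝ ∞ φ (e' q) := by
    rw [← contMDiffAt_iff_contDiffAt]
    refine ContMDiffAt.comp (I' := 𝓘(ℝ, E4)) (e' q) (g := e) ?_ ?_
    · rw [e'.left_inv hq']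
      exact contMDiffAt_of_mem_maximalAtlas he hq
    · exact (contMDiffOn_symm_of_mem_maximalAtlas he').contMDiffAt
        (e'.open_target.mem_nhds (e'.map_source hq'))
  have key : coordRep e' η =ᶠ[𝓝 (e' q)]
      fun y ↦ (coordRep e η (φ y)).compContinuousLinearMap (fderiv ℝ φ y) := by
    filter_upwards [hU, eventually_mem_nhds_iff.2 hU] with y hy hyU
    have hx : e'.symm y = e.symm (φ y) := (e.left_inv hy.2).symm
    have hcongr : ∀ (x x' : M), x = x' → ∀ w w' : Fin k → E4, w = w' →
        η x (w : Fin k → TangentSpace 𝓘(ℝ, E4) x) = η x' (w' : Fin k → TangentSpace 𝓘(ℝ, E4) x') := by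
      rintro x _ rfl w _ rfl; rfl
    have hφy : MDifferentiableAt 𝓘(ℝ, E4) 𝓘(ℝ, E4) φ y :=
      (hes _ hy.2).comp y (het' y hy.1)
    have hd : mfderiv 𝓘(ℝ, E4) 𝓘(ℝ, E4) (e.symm ∘ φ) y =
        (mfderiv 𝓘(ℝ, E4) 𝓘(ℝ, E4) e.symm (φ y)).comp (mfderiv 𝓘(ℝ, E4) 𝓘(ℝ, E4) φ y) :=
      mfderiv_comp y (het _ (e.map_source hy.2)) hφy
    have hev : e'.symm =ᶠ[𝓝 y] e.symm ∘ φ := by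
      filter_upwards [hyU] with z hz using (e.left_inv hz.2).symm
    ext v
    refine hcongr _ _ hx _ _ (funext fun i ↦ ?_)
    have h2 : (mfderiv 𝓘(ℝ, E4) 𝓘(ℝ, E4) e'.symm y (v i) : E4) =
        mfderiv 𝓘(ℝ, E4) 𝓘(ℝ, E4) (e.symm ∘ φ) y (v i) := by
      rw [hev.mfderiv_eq]
      rfl
    refine h2.trans ?_
    rw [hd, mfderiv_eq_fderiv]
    rfl
  have h1 : extD e' η q = ((extDeriv (coordRep e η) (φ (e' q))).compContinuousLinearMap
      (fderiv ℝ φ (e' q))).compContinuousLinearMap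
        (mfderiv 𝓘(ℝ, E4) 𝓘(ℝ, E4) e' q : TangentSpace 𝓘(ℝ, E4) q →L[ℝ] E4) := by
    rw [← extDeriv_pullback (by rwa [hφq]) hφd (by simp; exact WithTop.coe_le_coe.2 le_top),
      extD, extDeriv, extDeriv,
      key.fderiv_eq]
  have hev : e =ᶠ[𝓝 q] φ ∘ e' := by
    filter_upwards [e'.open_source.mem_nhds hq'] with x hx
    simp [hφ, hx]
  have h2 : (mfderiv 𝓘(ℝ, E4) 𝓘(ℝ, E4) (φ ∘ e') q : TangentSpace 𝓘(ℝ, E4) q →L[ℝ] E4) =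
      (fderiv ℝ φ (e' q)).comp (mfderiv 𝓘(ℝ, E4) 𝓘(ℝ, E4) e' q) := by
    rw [← mfderiv_eq_fderiv]
    exact mfderiv_comp q (hφd.contMDiffAt.mdifferentiableAt (by simp)) (hes' q hq')
  have h3 : (mfderiv 𝓘(ℝ, E4) 𝓘(ℝ, E4) e q : TangentSpace 𝓘(ℝ, E4) q →L[ℝ] E4) =
      (fderiv ℝ φ (e' q)).comp (mfderiv 𝓘(ℝ, E4) 𝓘(ℝ, E4) e' q) := by
    rw [← h2]; exact hev.mfderiv_eq
  rw [h1, hφq, extD, h3]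
  rfl

variable [IsManifold 𝓘(ℝ, E4) ∞ M]

/-- The 1-form `X♭ = g(X, ·)`, as a field of covectors. -/
def flat (g : LorentzMetric M) (X : (q : M) → TangentSpace 𝓘(ℝ, E4) q) (q : M) :
    TangentSpace 𝓘(ℝ, E4) q →L[ℝ] ℝ :=
  g.inner q (X q)

/-- The 1-form `X♭ = g(X, ·)`, as a differential 1-form. -/
def flatForm (g : LorentzMetric M) (X : (q : M) → TangentSpace 𝓘(ℝ, E4) q) : Form M 1 :=
  fun q ↦ wedge ![flat g X q]

/-- The matrix `(g_{ij})` of the metric in the chart `e`. -/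
def gram (g : LorentzMetric M) (e : OpenPartialHomeomorph M E4) (q : M) :
    Matrix (Fin 4) (Fin 4) ℝ :=
  Matrix.of fun i j ↦ g.inner q (coordVec e i q) (coordVec e j q)

/-- The vector `∂^i = g^{ij} ∂_j`. -/
def coordVecUp (g : LorentzMetric M) (e : OpenPartialHomeomorph M E4) (i : Fin 4) (q : M) :
    TangentSpace 𝓘(ℝ, E4) q :=
  ∑ j, (gram g e q)⁻¹ i j • coordVec e j q

/-- The vector field `θ♯ = g^{ij} θ_i ∂_j`. -/
def sharp (g : LorentzMetric M) (e : OpenPartialHomeomorph M E4) (θ : Form M 1) (q : M) :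
    TangentSpace 𝓘(ℝ, E4) q :=
  ∑ i, θ q ![coordVec e i q] • coordVecUp g e i q

/-- The permutation symbol: the sign of `i` if `i` is a permutation, and `0` otherwise. -/
def permSymbol (i : Fin 4 → Fin 4) : ℝ :=
  ((1 : Matrix (Fin 4) (Fin 4) ℝ).submatrix i id).det

/-- The Hodge star on the domain of the chart `e`, oriented by its coordinates:
`(*η)_{j₁…jₘ} = (1/k!) √|det g| η^{i₁…iₖ} ε_{i₁…iₖ j₁…jₘ}`, where `k + m = 4`. -/
def hodge (g : LorentzMetric M) (e : OpenPartialHomeomorph M E4) {k m : ℕ} (h : 4 = k + m)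
    (η : Form M k) : Form M m := fun q ↦
  ∑ i : Fin k → Fin 4, ∑ j : Fin m → Fin 4,
    ((k.factorial : ℝ)⁻¹ * (m.factorial : ℝ)⁻¹ * √|(gram g e q).det| *
      η q (fun r ↦ coordVecUp g e (i r) q) * permSymbol (Fin.append i j ∘ Fin.cast h)) •
      wedge (fun r ↦ coordForm e (j r) q)

/-! ### Force-free electrodynamics -/

/-- The current density `j = * d * F`. The Hodge star occurs twice, so that `j` does not depend on
the orientation. -/
def current (g : LorentzMetric M) (e : OpenPartialHomeomorph M E4) (F : Form M 2) : Form M 1 :=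
  hodge g e (k := 3) (m := 1) rfl (extD e (hodge g e (k := 2) (m := 2) rfl F))

/-- The scalar `F² = F_{ij} F^{ij}`. -/
def normSq (g : LorentzMetric M) (e : OpenPartialHomeomorph M E4) (F : Form M 2) (q : M) : ℝ :=
  ∑ i, ∑ j, F q ![coordVec e i q, coordVec e j q] * F q ![coordVecUp g e i q, coordVecUp g e j q]

/-- `F` is a null and force-free electromagnetic field on the domain of the chart `e`. -/
structure IsNullForceFree (g : LorentzMetric M) (e : OpenPartialHomeomorph M E4)
    (F : Form M 2) : Prop where
  smooth : IsSmoothForm e F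
  closed : ∀ q ∈ e.source, extD e F q = 0
  forceFree : ∀ q ∈ e.source, ∀ w, F q ![sharp g e (current g e F) q, w] = 0
  null : ∀ q ∈ e.source, normSq g e F q = 0

/-- The kernel of a 2-form at a point. -/
def kernel (F : Form M 2) (q : M) : Set (TangentSpace 𝓘(ℝ, E4) q) :=
  {v | ∀ w, F q ![v, w] = 0}

/-- `F` is a null force-free field on the domain of the chart `e`, and the kernel of `F` is at
each point exactly the tangent space of the leaf. -/
structure IsLeafSolution (g : LorentzMetric M) (𝓕 : Foliation M)
    (e : OpenPartialHomeomorph M E4) (F : Form M 2) : Prop where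
  isNullForceFree : IsNullForceFree g e F
  kernel_eq : ∀ q ∈ e.source, kernel F q = 𝓕.tangent q

/-! ### Null foliation adapted frames -/

/-- The vector field `X` is smooth on `U`. -/
def IsSmoothVectorField (U : Set M) (X : (q : M) → TangentSpace 𝓘(ℝ, E4) q) : Prop :=
  ContMDiffOn 𝓘(ℝ, E4) 𝓘(ℝ, E4).tangent ∞ (fun q ↦ (⟨q, X q⟩ : TangentBundle 𝓘(ℝ, E4) M)) U

/-- `(s, l, a, n)`, where `a = α♯`, is a null foliation adapted frame on `U`. -/
structure IsAdaptedFrame (g : LorentzMetric M) (𝓕 : Foliation M) (U : Set M)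
    (s l a n : (q : M) → TangentSpace 𝓘(ℝ, E4) q) : Prop where
  smooth_s : IsSmoothVectorField U s
  smooth_l : IsSmoothVectorField U l
  smooth_a : IsSmoothVectorField U a
  smooth_n : IsSmoothVectorField U n
  tangent_eq : ∀ q ∈ U, 𝓕.tangent q = (Submodule.span ℝ {s q, l q} : Set _)
  s_s : ∀ q ∈ U, g.inner q (s q) (s q) = 1
  a_a : ∀ q ∈ U, g.inner q (a q) (a q) = 1
  l_l : ∀ q ∈ U, g.inner q (l q) (l q) = 0
  n_n : ∀ q ∈ U, g.inner q (n q) (n q) = 0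
  n_l : ∀ q ∈ U, g.inner q (n q) (l q) = -1
  n_s : ∀ q ∈ U, g.inner q (n q) (s q) = 0
  n_a : ∀ q ∈ U, g.inner q (n q) (a q) = 0
  l_s : ∀ q ∈ U, g.inner q (l q) (s q) = 0
  l_a : ∀ q ∈ U, g.inner q (l q) (a q) = 0
  s_a : ∀ q ∈ U, g.inner q (s q) (a q) = 0

/-- `κ = (α₃ l♭₄ - α₄ l♭₃)⁻¹`, where `α = a♭`. -/
def kappa (g : LorentzMetric M) (e : OpenPartialHomeomorph M E4)
    (l a : (q : M) → TangentSpace 𝓘(ℝ, E4) q) (q : M) : ℝ :=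
  (flat g a q (coordVec e 2 q) * flat g l q (coordVec e 3 q) -
    flat g a q (coordVec e 3 q) * flat g l q (coordVec e 2 q))⁻¹

/-- The 2-form `(u κ) α ∧ l♭`, where `α = a♭`. -/
def leafField (g : LorentzMetric M) (e : OpenPartialHomeomorph M E4)
    (l a : (q : M) → TangentSpace 𝓘(ℝ, E4) q) (u : M → ℝ) : Form M 2 := fun q ↦
  (u q * kappa g e l a q) • wedge ![flat g a q, flat g l q]

/-- `u` is a smooth function on the domain of the adapted chart `e` that is constant on the leaves
in this domain, that is, `u = u(x³, x⁴)`. -/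
structure IsLeafFunction (e : OpenPartialHomeomorph M E4) (u : M → ℝ) : Prop where
  smooth : ContMDiffOn 𝓘(ℝ, E4) 𝓘(ℝ, ℝ) ∞ u e.source
  const : ∀ q ∈ e.source, ∀ q' ∈ e.source, (e q) 2 = (e q') 2 → (e q) 3 = (e q') 3 → u q = u q'

/-- The conditions `dα(l, α♯) = ds♭(l, s)` and `dl♭(l, α♯) = 0`, where `a = α♯`. -/
def FrameCondition (g : LorentzMetric M) (e : OpenPartialHomeomorph M E4)
    (s l a : (q : M) → TangentSpace 𝓘(ℝ, E4) q) : Prop :=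
  ∀ q ∈ e.source,
    extD e (flatForm g a) q ![l q, a q] = extD e (flatForm g s) q ![l q, s q] ∧
    extD e (flatForm g l) q ![l q, a q] = 0

end NullFF

end

/-!
Where the metric is not involved the problem is elementary. A curve in a leaf stays in a single
slice of the adapted chart, because a connected subset of a countable set is a point
(`IsFlatChart.coordForm_eq_zero`). Hence `s` and `l`, which span the tangent space of the leaf,
annihilate `dx³` and `dx⁴`, and so do `α` and `l♭` by the metric relations; comparing components
gives `κ α ∧ l♭ = dx³ ∧ dx⁴` (`IsNullTetrad.conormal_wedge_eq`), so that `F_u = u dx³ ∧ dx⁴`. Such a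
form is closed if and only if `u` is constant on the (connected) slices, its kernel is the tangent
space of the leaf exactly where `u ≠ 0`, and every 2-form with that kernel is of this type. The
scalar `F²` vanishes because `α` and `l♭` are orthogonal and `l` is null.

It remains to see when `F = φ α ∧ l♭`, with `φ = u κ`, is force-free at a point where `φ ≠ 0`. Up to
a locally constant sign `*F = φ s♭ ∧ l♭` (`IsNullTetrad.hodge_two_eq`). The vector `j♯` is in the
kernel of `F` if and only if `j(α♯) = j(l) = 0`, and since `j = *d*F` these are, up to nonzero
factors, the components `(d*F)(s, l, n)` and `(d*F)(s, l, α♯)`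
(`IsNullTetrad.hodge_three_eq_zero_iff`). They are, up to the same sign,

* `l(φ) + φ (ds♭(l, s) - dl♭(l, n))`, and
* `-φ dl♭(l, α♯)`,

while `dF(l, α♯, n) = 0` reads `l(φ) + φ (dα(l, α♯) - dl♭(l, n)) = 0`. Subtracting, the force-free
condition becomes `dα(l, α♯) = ds♭(l, s)` and `dl♭(l, α♯) = 0` (`IsAdaptedFrame.forceFree_iff`). Where
`u = 0` the field vanishes, and there is nothing to check.
-/

noncomputable section

namespace NullFF

/-! ### Wedge products, dual bases and null tetrads -/

section Pointwise

variable {V : Type*} [AddCommGroup V] [Module ℝ V] [TopologicalSpace V]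

section Wedge

variable [IsTopologicalAddGroup V] [ContinuousSMul ℝ V]

theorem wedge_apply {k : ℕ} (θ : Fin k → (V →L[ℝ] ℝ)) (v : Fin k → V) :
    wedge θ v = ∑ σ : Equiv.Perm (Fin k), Equiv.Perm.sign σ • ∏ r, θ r (v (σ r)) := by
  simp [wedge, ContinuousMultilinearMap.alternatization_apply_apply]

theorem wedge_one_apply (θ : Fin 1 → (V →L[ℝ] ℝ)) (v : Fin 1 → V) :
    wedge θ v = θ 0 (v 0) := by
  simp [wedge_apply]

theorem wedge_two_apply (θ : Fin 2 → (V →L[ℝ] ℝ)) (v : Fin 2 → V) :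
    wedge θ v = θ 0 (v 0) * θ 1 (v 1) - θ 0 (v 1) * θ 1 (v 0) := by
  rw [wedge_apply, show (Finset.univ : Finset (Equiv.Perm (Fin 2))) = {1, Equiv.swap 0 1} by decide,
    Finset.sum_pair (by decide)]
  simp [sub_eq_add_neg]

end Wedge

/-- `x` is a basis of `V`, and `ξ` is the dual basis. -/
structure IsDualPair (x : Fin 4 → V) (ξ : Fin 4 → (V →L[ℝ] ℝ)) : Prop where
  dual : ∀ i j, ξ i (x j) = if i = j then 1 else 0
  expand : ∀ v, v = ∑ i, ξ i v • x i

/-- The 4-form `ξ⁰ ∧ ξ¹ ∧ ξ² ∧ ξ³`. -/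
def volForm (ξ : Fin 4 → (V →L[ℝ] ℝ)) : V [⋀^Fin 4]→ₗ[ℝ] ℝ :=
  Matrix.detRowAlternating.compLinearMap (LinearMap.pi fun i ↦ (ξ i : V →ₗ[ℝ] ℝ))

theorem volForm_apply (ξ : Fin 4 → (V →L[ℝ] ℝ)) (v : Fin 4 → V) :
    volForm ξ v = (Matrix.of fun r i ↦ ξ i (v r)).det := rfl

theorem volForm_explicit (ξ : Fin 4 → (V →L[ℝ] ℝ)) (a b c d : V) :
    volForm ξ ![a, b, c, d] =
      ξ 0 a * (ξ 1 b * (ξ 2 c * ξ 3 d - ξ 3 c * ξ 2 d) - ξ 2 b * (ξ 1 c * ξ 3 d - ξ 3 c * ξ 1 d)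
        + ξ 3 b * (ξ 1 c * ξ 2 d - ξ 2 c * ξ 1 d))
      - ξ 1 a * (ξ 0 b * (ξ 2 c * ξ 3 d - ξ 3 c * ξ 2 d) - ξ 2 b * (ξ 0 c * ξ 3 d - ξ 3 c * ξ 0 d)
        + ξ 3 b * (ξ 0 c * ξ 2 d - ξ 2 c * ξ 0 d))
      + ξ 2 a * (ξ 0 b * (ξ 1 c * ξ 3 d - ξ 3 c * ξ 1 d) - ξ 1 b * (ξ 0 c * ξ 3 d - ξ 3 c * ξ 0 d)
        + ξ 3 b * (ξ 0 c * ξ 1 d - ξ 1 c * ξ 0 d))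
      - ξ 3 a * (ξ 0 b * (ξ 1 c * ξ 2 d - ξ 2 c * ξ 1 d) - ξ 1 b * (ξ 0 c * ξ 2 d - ξ 2 c * ξ 0 d)
        + ξ 2 b * (ξ 0 c * ξ 1 d - ξ 1 c * ξ 0 d)) := by
  rw [volForm_apply, Matrix.det_succ_row_zero]
  simp [Fin.sum_univ_succ, Matrix.det_fin_three, Fin.succAbove]
  ring

/-- The permutation symbol gives the components of the volume form. -/
theorem IsDualPair.permSymbol_eq {x : Fin 4 → V} {ξ : Fin 4 → (V →L[ℝ] ℝ)} (h : IsDualPair x ξ)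
    (i : Fin 4 → Fin 4) : permSymbol i = volForm ξ (x ∘ i) := by
  rw [volForm_apply, permSymbol]
  congr 1
  ext r c
  simp [h.dual, Matrix.one_apply, eq_comm]

/-- Linearity in one slot, written in a basis. -/
theorem IsDualPair.sum_volForm {x : Fin 4 → V} {ξ : Fin 4 → (V →L[ℝ] ℝ)} (h : IsDualPair x ξ)
    (v : Fin 4 → V) (r : Fin 4) (w : V) :
    ∑ i, ξ i w * volForm ξ (Function.update v r (x i)) = volForm ξ (Function.update v r w) := by
  conv_rhs => rw [h.expand w]
  simp [AlternatingMap.map_update_sum, AlternatingMap.map_update_smul]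

theorem IsDualPair.permSymbol_four {x : Fin 4 → V} {ξ : Fin 4 → (V →L[ℝ] ℝ)} (h : IsDualPair x ξ)
    (i : Fin 4 → Fin 4) : permSymbol i = volForm ξ ![x (i 0), x (i 1), x (i 2), x (i 3)] := by
  rw [h.permSymbol_eq]
  congr 1
  ext r
  fin_cases r <;> rfl

theorem IsDualPair.sum_volForm_slot_two {x : Fin 4 → V} {ξ : Fin 4 → (V →L[ℝ] ℝ)}
    (h : IsDualPair x ξ) (a b v d : V) :
    ∑ i, ξ i v * volForm ξ ![a, b, x i, d] = volForm ξ ![a, b, v, d] := by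
  have hu (z : V) : Function.update ![a, b, v, d] 2 z = ![a, b, z, d] := by
    ext r; fin_cases r <;> rfl
  have := h.sum_volForm ![a, b, v, d] 2 v
  simpa only [hu] using this

theorem IsDualPair.sum_volForm_slot_three {x : Fin 4 → V} {ξ : Fin 4 → (V →L[ℝ] ℝ)}
    (h : IsDualPair x ξ) (a b c v : V) :
    ∑ i, ξ i v * volForm ξ ![a, b, c, x i] = volForm ξ ![a, b, c, v] := by
  have hu (z : V) : Function.update ![a, b, c, v] 3 z = ![a, b, c, z] := by
    ext r; fin_cases r <;> rfl
  have := h.sum_volForm ![a, b, c, v] 3 v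
  simpa only [hu] using this

/-- A contraction with the inverse metric in every slot can be computed in any pair of dual
bases. Here `ξ i (f p)` are the coordinates of `f p` in the basis `x`, and the metric dual `xu i`
of `x i` has the same coordinates in the basis `f'`. -/
theorem sum_contract {k : ℕ} {x xu f f' : Fin 4 → V} {ξ : Fin 4 → (V →L[ℝ] ℝ)}
    (hf : ∀ p, f p = ∑ i, ξ i (f p) • x i) (hxu : ∀ i, xu i = ∑ p, ξ i (f p) • f' p)
    (P Q : MultilinearMap ℝ (fun _ : Fin k ↦ V) ℝ) :
    ∑ i : Fin k → Fin 4, P (xu ∘ i) * Q (x ∘ i) = ∑ p : Fin k → Fin 4, P (f' ∘ p) * Q (f ∘ p) := by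
  have h1 (i : Fin k → Fin 4) :
      P (xu ∘ i) = ∑ p : Fin k → Fin 4, (∏ r, ξ (i r) (f (p r))) * P (f' ∘ p) := by
    have : xu ∘ i = fun r ↦ ∑ p, ξ (i r) (f p) • f' p := funext fun r ↦ hxu (i r)
    rw [this, MultilinearMap.map_sum]
    exact Finset.sum_congr rfl fun p _ ↦ MultilinearMap.map_smul_univ P _ _
  have h2 (p : Fin k → Fin 4) :
      Q (f ∘ p) = ∑ i : Fin k → Fin 4, (∏ r, ξ (i r) (f (p r))) * Q (x ∘ i) := by
    have : f ∘ p = fun r ↦ ∑ i, ξ i (f (p r)) • x i := funext fun r ↦ hf (p r)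
    rw [this, MultilinearMap.map_sum]
    exact Finset.sum_congr rfl fun i _ ↦ MultilinearMap.map_smul_univ Q _ _
  simp_rw [h1, h2, Finset.sum_mul, Finset.mul_sum]
  rw [Finset.sum_comm]
  exact Finset.sum_congr rfl fun p _ ↦ Finset.sum_congr rfl fun i _ ↦ by ring

theorem sum_fin_two_fun {α : Type*} [Fintype α] (f : (Fin 2 → α) → ℝ) :
    ∑ i, f i = ∑ a, ∑ b, f ![a, b] := by
  rw [← (finTwoArrowEquiv α).symm.sum_comp, Fintype.sum_prod_type]
  rfl

theorem sum_fin_three_fun {α : Type*} [Fintype α] (f : (Fin 3 → α) → ℝ) :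
    ∑ i, f i = ∑ a, ∑ b, ∑ c, f ![a, b, c] := by
  rw [← (Fin.consEquiv fun _ : Fin 3 ↦ α).sum_comp, Fintype.sum_prod_type]
  exact Finset.sum_congr rfl fun a _ ↦ sum_fin_two_fun _

/-- `s, l, a, n` are the vectors of a null adapted frame at a point, for the scalar product `B`. -/
structure IsNullTetrad (B : V →L[ℝ] V →L[ℝ] ℝ) (s l a n : V) : Prop where
  symm : ∀ v w, B v w = B w v
  s_s : B s s = 1
  a_a : B a a = 1
  l_l : B l l = 0
  n_n : B n n = 0
  n_l : B n l = -1
  n_s : B n s = 0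
  n_a : B n a = 0
  l_s : B l s = 0
  l_a : B l a = 0
  s_a : B s a = 0

namespace IsNullTetrad

variable {B : V →L[ℝ] V →L[ℝ] ℝ} {s l a n : V} (h : IsNullTetrad B s l a n)
include h

/-- The frame is a basis, with dual basis `s♭, -n♭, α, -l♭`. -/
theorem expand (hV : Module.finrank ℝ V = 4) (v : V) :
    v = B s v • s - B n v • l + B a v • a - B l v • n := by
  have hli : LinearIndependent ℝ ![s, l, a, n] := by
    rw [Fintype.linearIndependent_iff]
    intro c hc
    simp only [Fin.sum_univ_four, Matrix.cons_val] at hc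
    have e1 := congrArg (B s) hc
    have e2 := congrArg (B l) hc
    have e3 := congrArg (B a) hc
    have e4 := congrArg (B n) hc
    simp [h.symm s l, h.symm s n, h.symm l n, h.symm a s, h.symm a l, h.symm a n,
      h.s_s, h.a_a, h.l_l, h.n_n, h.n_l, h.n_s, h.n_a, h.l_s, h.l_a, h.s_a] at e1 e2 e3 e4
    intro i
    fin_cases i <;> simp_all
  have hspan := hli.span_eq_top_of_card_eq_finrank (by simp [hV])
  have hv : v ∈ Submodule.span ℝ (Set.range ![s, l, a, n]) := hspan ▸ Submodule.mem_top
  obtain ⟨c, rfl⟩ := (Submodule.mem_span_range_iff_exists_fun ℝ).1 hv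
  simp [Fin.sum_univ_four, h.symm s l, h.symm s n, h.symm l n, h.symm a s, h.symm a l, h.symm a n,
      h.s_s, h.a_a, h.l_l, h.n_n, h.n_l, h.n_s, h.n_a, h.l_s, h.l_a, h.s_a]

variable {x xu : Fin 4 → V} {ξ : Fin 4 → (V →L[ℝ] ℝ)}

/-- The inverse metric is `∑ ∂^i ⊗ ∂_i = s ⊗ s - n ⊗ l + a ⊗ a - l ⊗ n`, applied in `k` slots. -/
theorem sum_contract (hV : Module.finrank ℝ V = 4) (hd : IsDualPair x ξ)
    (hxu : ∀ i v, B (xu i) v = ξ i v) {k : ℕ} (P Q : MultilinearMap ℝ (fun _ : Fin k ↦ V) ℝ) :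
    ∑ i : Fin k → Fin 4, P (xu ∘ i) * Q (x ∘ i) =
      ∑ p : Fin k → Fin 4, P (![s, -n, a, -l] ∘ p) * Q (![s, l, a, n] ∘ p) := by
  refine NullFF.sum_contract (ξ := ξ) (fun p ↦ hd.expand _) (fun i ↦ ?_) P Q
  have := h.expand hV (xu i)
  simp only [h.symm _ (xu i), hxu] at this
  rw [Fin.sum_univ_four]
  simp only [Matrix.cons_val]
  rw [this]
  module

end IsNullTetrad

/-! ### Volume, conormal covectors and the Hodge star in a null tetrad -/

theorem IsDualPair.apply_one {x : Fin 4 → V} {ξ : Fin 4 → (V →L[ℝ] ℝ)} (h : IsDualPair x ξ)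
    (θ : V [⋀^Fin 1]→L[ℝ] ℝ) (v : V) : θ ![v] = ∑ i, θ ![x i] * ξ i v := by
  have hu (z : V) : Function.update ![v] 0 z = ![z] := by
    ext1 r; fin_cases r; rfl
  have h1 := θ.toAlternatingMap.map_update_sum Finset.univ 0 (fun i ↦ ξ i v • x i) ![v]
  rw [← h.expand v] at h1
  have h2 (c : ℝ) (z : V) := θ.toAlternatingMap.map_update_smul ![v] 0 c z
  simp only [hu] at h1 h2
  exact h1.trans (Finset.sum_congr rfl fun i _ ↦ (h2 _ _).trans (mul_comm _ _))

/-- The vectors `g^{ij} ∂_j` represent the dual basis: `g(∂^i, v) = dxⁱ(v)`. -/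
theorem IsDualPair.inner_inv_gram {x : Fin 4 → V} {ξ : Fin 4 → (V →L[ℝ] ℝ)}
    (h : IsDualPair x ξ) {B : V →L[ℝ] V →L[ℝ] ℝ}
    (hdet : (Matrix.of fun i j ↦ B (x i) (x j)).det ≠ 0) (i : Fin 4) (v : V) :
    B (∑ j, (Matrix.of fun i j ↦ B (x i) (x j))⁻¹ i j • x j) v = ξ i v := by
  set m := Matrix.of fun i j ↦ B (x i) (x j) with hm
  have h1 : m⁻¹ * m = 1 := Matrix.nonsing_inv_mul m hdet.isUnit
  have h2 (k : Fin 4) : B (∑ j, m⁻¹ i j • x j) (x k) = if i = k then 1 else 0 := by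
    rw [← Matrix.one_apply, ← h1, Matrix.mul_apply]
    simp [hm]
  generalize ∑ j, m⁻¹ i j • x j = z at h2 ⊢
  conv_lhs => rw [h.expand v]
  simp [h2]

namespace IsNullTetrad

variable {B : V →L[ℝ] V →L[ℝ] ℝ} {s l a n : V} (h : IsNullTetrad B s l a n)
  {x : Fin 4 → V} {ξ : Fin 4 → (V →L[ℝ] ℝ)}
include h

/-- The matrix of the components of the covectors of the frame, times the transposed matrix of
the components of its vectors, is the Gram matrix of the frame, of determinant `-1`. -/
theorem det_flat_mul_volForm (hd : IsDualPair x ξ) :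
    (Matrix.of fun r i ↦ B (![s, l, a, n] r) (x i)).det * volForm ξ ![s, l, a, n] = -1 := by
  rw [volForm_apply, ← Matrix.det_transpose (Matrix.of fun r i ↦ ξ i (![s, l, a, n] r)),
    ← Matrix.det_mul]
  have h1 : (Matrix.of fun r i ↦ B (![s, l, a, n] r) (x i)) *
      (Matrix.of fun r i ↦ ξ i (![s, l, a, n] r)).transpose =
      Matrix.of fun r p ↦ B (![s, l, a, n] r) (![s, l, a, n] p) := by
    ext r p
    conv_rhs => rw [Matrix.of_apply, hd.expand (![s, l, a, n] p), map_sum]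
    simp [Matrix.mul_apply, mul_comm]
  rw [h1, Matrix.det_succ_row_zero]
  simp [Fin.sum_univ_succ, Matrix.det_fin_three, Fin.succAbove, h.symm l n,
    h.symm a s, h.symm a l, h.symm a n, h.s_s, h.a_a, h.l_l, h.n_n, h.n_l, h.n_s, h.n_a, h.l_s,
    h.l_a, h.s_a]

/-- `det g_{ij} < 0`, and its absolute value is the square of the determinant of the components of
the covectors of the frame. -/
theorem det_gram (hd : IsDualPair x ξ) :
    (Matrix.of fun i j ↦ B (x i) (x j)).det =
      -(Matrix.of fun r i ↦ B (![s, l, a, n] r) (x i)).det ^ 2 := by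
  have h1 : (Matrix.of fun r i ↦ B (![s, l, a, n] r) (x i)) =
      (Matrix.of fun r i ↦ ξ i (![s, l, a, n] r)) * Matrix.of fun i j ↦ B (x i) (x j) := by
    ext r p
    rw [Matrix.of_apply, hd.expand (![s, l, a, n] r), map_sum]
    simp [Matrix.mul_apply]
  have h2 := h.det_flat_mul_volForm hd
  have h3 := congrArg Matrix.det h1
  rw [Matrix.det_mul, ← volForm_apply] at h3
  linear_combination (Matrix.of fun i j ↦ B (x i) (x j)).det * h2 +
    (Matrix.of fun r i ↦ B (![s, l, a, n] r) (x i)).det * h3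

/-- The frame is orthonormal up to signs, so its volume is `±1`; the sign is opposite
to that of the determinant of the components of its covectors. -/
theorem sqrt_mul_volForm (hd : IsDualPair x ξ) :
    √|(Matrix.of fun i j ↦ B (x i) (x j)).det| * volForm ξ ![s, l, a, n] =
      -SignType.sign (Matrix.of fun r i ↦ B (![s, l, a, n] r) (x i)).det := by
  have h2 := h.det_flat_mul_volForm hd
  rw [h.det_gram hd, abs_neg, abs_pow, Real.sqrt_sq_eq_abs, abs_abs, ← self_mul_sign, mul_right_comm,
    h2]
  ring

theorem volForm_ne_zero (hd : IsDualPair x ξ) : volForm ξ ![s, l, a, n] ≠ 0 := by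
  intro h0
  simpa [h0] using h.det_flat_mul_volForm hd

theorem det_flat_ne_zero (hd : IsDualPair x ξ) :
    (Matrix.of fun r i ↦ B (![s, l, a, n] r) (x i)).det ≠ 0 := by
  intro h0
  simpa [h0] using h.det_flat_mul_volForm hd

/-- The leaf directions `s, l` span the orthogonal complement of `α♯, l`. -/
theorem mem_span_iff (hV : Module.finrank ℝ V = 4) (v : V) :
    v ∈ Submodule.span ℝ {s, l} ↔ B a v = 0 ∧ B l v = 0 := by
  constructor
  · intro hv
    obtain ⟨c, d, rfl⟩ := Submodule.mem_span_pair.1 hv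
    simp [h.symm a s, h.symm a l, h.l_l, h.l_s, h.l_a, h.s_a]
  · rintro ⟨h1, h2⟩
    rw [h.expand hV v, h1, h2]
    exact Submodule.mem_span_pair.2 ⟨B s v, -B n v, by module⟩

/-- A covector that annihilates `s` and `l` is a combination of `α` and `l♭`. -/
theorem covector_eq (hV : Module.finrank ℝ V = 4) {ζ : V →L[ℝ] ℝ} (hs : ζ s = 0) (hl : ζ l = 0)
    (v : V) : ζ v = ζ a * B a v - ζ n * B l v := by
  conv_lhs => rw [h.expand hV v]
  simp [hs, hl]
  ring

/-- `κ α ∧ l♭ = dx³ ∧ dx⁴`: both are 2-forms annihilated by `s` and `l`, hence proportional, and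
they agree on `(∂₃, ∂₄)`. The coordinates `x³, x⁴` have index `2, 3`. -/
theorem conormal_wedge_eq (hV : Module.finrank ℝ V = 4) (hd : IsDualPair x ξ)
    (h2s : ξ 2 s = 0) (h2l : ξ 2 l = 0) (h3s : ξ 3 s = 0) (h3l : ξ 3 l = 0) :
    B a (x 2) * B l (x 3) - B a (x 3) * B l (x 2) ≠ 0 ∧ ∀ v w,
      (B a (x 2) * B l (x 3) - B a (x 3) * B l (x 2))⁻¹ * (B a v * B l w - B a w * B l v) =
        ξ 2 v * ξ 3 w - ξ 2 w * ξ 3 v := by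
  have e (v w : V) : ξ 2 v * ξ 3 w - ξ 2 w * ξ 3 v =
      (ξ 2 n * ξ 3 a - ξ 2 a * ξ 3 n) * (B a v * B l w - B a w * B l v) := by
    rw [h.covector_eq hV h2s h2l v, h.covector_eq hV h2s h2l w, h.covector_eq hV h3s h3l v,
      h.covector_eq hV h3s h3l w]
    ring
  have e1 := e (x 2) (x 3)
  rw [hd.dual, hd.dual, hd.dual, hd.dual, if_pos rfl, if_pos rfl, if_neg (by decide), mul_one,
    zero_mul, sub_zero] at e1
  have h0 : B a (x 2) * B l (x 3) - B a (x 3) * B l (x 2) ≠ 0 := right_ne_zero_of_mul_eq_one e1.symm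
  refine ⟨h0, fun v w ↦ ?_⟩
  rw [e, eq_inv_of_mul_eq_one_left e1.symm]

theorem mem_span_iff_of_annihilated (hV : Module.finrank ℝ V = 4) (hd : IsDualPair x ξ)
    (h2s : ξ 2 s = 0) (h2l : ξ 2 l = 0) (h3s : ξ 3 s = 0) (h3l : ξ 3 l = 0) (v : V) :
    v ∈ Submodule.span ℝ {s, l} ↔ ξ 2 v = 0 ∧ ξ 3 v = 0 := by
  constructor
  · intro hv
    obtain ⟨c, d, rfl⟩ := Submodule.mem_span_pair.1 hv
    simp [*]
  · rintro ⟨h2, h3⟩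
    obtain ⟨h0, hw⟩ := h.conormal_wedge_eq hV hd h2s h2l h3s h3l
    have e1 := hw v a
    have e2 := hw v n
    have ha : B a a = 1 := h.a_a
    have h4 : B l a = 0 := h.l_a
    have h5 : B a n = 0 := by rw [h.symm, h.n_a]
    have h6 : B l n = -1 := by rw [h.symm, h.n_l]
    rw [h.mem_span_iff hV]
    rw [h2, h3, ha, h4] at e1
    rw [h2, h3, h5, h6] at e2
    have hi := inv_ne_zero h0
    constructor
    · have : _ = (0 : ℝ) := e2.trans (by ring)
      rcases mul_eq_zero.1 this with h' | h'
      · exact absurd h' hi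
      · linarith
    · have : _ = (0 : ℝ) := e1.trans (by ring)
      rcases mul_eq_zero.1 this with h' | h'
      · exact absurd h' hi
      · linarith

variable {xu : Fin 4 → V}

/-- Contraction of a 3-form with the volume form, with `α♯` or `l` in the remaining slot. Only the
six arrangements of the other three frame vectors contribute, and the metric dual of the triple
`s, l, n` is `s, -n, -l`, that of `s, a, n` is `s, a, -l`. -/
theorem hodge_three (hV : Module.finrank ℝ V = 4) (hd : IsDualPair x ξ)
    (hxu : ∀ i v, B (xu i) v = ξ i v) (η : V [⋀^Fin 3]→L[ℝ] ℝ) :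
    ∑ i : Fin 3 → Fin 4, η (xu ∘ i) * volForm ξ ![a, x (i 0), x (i 1), x (i 2)] =
      -6 * volForm ξ ![s, l, a, n] * η ![s, l, n] ∧
    ∑ i : Fin 3 → Fin 4, η (xu ∘ i) * volForm ξ ![l, x (i 0), x (i 1), x (i 2)] =
      -6 * volForm ξ ![s, l, a, n] * η ![s, l, a] := by
  have h2 (X : V) : ∑ i : Fin 3 → Fin 4, η (xu ∘ i) * volForm ξ ![X, x (i 0), x (i 1), x (i 2)] =
      ∑ p : Fin 3 → Fin 4, η (![s, -n, a, -l] ∘ p) * volForm ξ ![X, (![s, l, a, n] : Fin 4 → V) (p 0),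
        (![s, l, a, n] : Fin 4 → V) (p 1), (![s, l, a, n] : Fin 4 → V) (p 2)] := by
    have h1 := h.sum_contract hV hd hxu η.toMultilinearMap ((volForm ξ).curryLeft X).toMultilinearMap
    have hQ (f : Fin 4 → V) (i : Fin 3 → Fin 4) :
        ((volForm ξ).curryLeft X).toMultilinearMap (f ∘ i) =
          volForm ξ ![X, f (i 0), f (i 1), f (i 2)] :=
      congrArg (volForm ξ) (by ext r; fin_cases r <;> rfl)
    simp only [hQ] at h1
    exact h1
  have hcomp (f : Fin 4 → V) (i j k : Fin 4) : f ∘ ![i, j, k] = ![f i, f j, f k] := by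
    ext r; fin_cases r <;> rfl
  -- the volume form vanishes when an argument is repeated, and changes sign under a transposition
  have z1 (u v w : V) : volForm ξ ![u, u, v, w] = 0 := by simp only [volForm_explicit]; ring
  have z2 (u v w : V) : volForm ξ ![u, v, u, w] = 0 := by simp only [volForm_explicit]; ring
  have z3 (u v w : V) : volForm ξ ![u, v, w, u] = 0 := by simp only [volForm_explicit]; ring
  have z4 (u v w : V) : volForm ξ ![w, u, u, v] = 0 := by simp only [volForm_explicit]; ring
  have z5 (u v w : V) : volForm ξ ![w, u, v, u] = 0 := by simp only [volForm_explicit]; ring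
  have z6 (u v w : V) : volForm ξ ![w, v, u, u] = 0 := by simp only [volForm_explicit]; ring
  have t1 (z u v w : V) : volForm ξ ![z, u, w, v] = -volForm ξ ![z, u, v, w] := by
    simp only [volForm_explicit]; ring
  have t2 (z u v w : V) : volForm ξ ![z, v, u, w] = -volForm ξ ![z, u, v, w] := by
    simp only [volForm_explicit]; ring
  have t3 (z u v w : V) : volForm ξ ![z, v, w, u] = volForm ξ ![z, u, v, w] := by
    rw [t1, t2, neg_neg]
  have t4 (z u v w : V) : volForm ξ ![z, w, u, v] = volForm ξ ![z, u, v, w] := by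
    rw [t2, t1, neg_neg]
  have t5 (z u v w : V) : volForm ξ ![z, w, v, u] = -volForm ξ ![z, u, v, w] := by
    rw [t2, t3]
  have p1 (u v w : V) : η ![u, w, v] = -η ![u, v, w] :=
    (congrArg η (by ext r; fin_cases r <;> rfl)).trans
      (η.toAlternatingMap.map_swap ![u, v, w] (show (1 : Fin 3) ≠ 2 by decide))
  have p2 (u v w : V) : η ![v, u, w] = -η ![u, v, w] :=
    (congrArg η (by ext r; fin_cases r <;> rfl)).trans
      (η.toAlternatingMap.map_swap ![u, v, w] (show (0 : Fin 3) ≠ 1 by decide))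
  have p3 (u v w : V) : η ![v, w, u] = η ![u, v, w] := by rw [p1, p2, neg_neg]
  have p4 (u v w : V) : η ![w, u, v] = η ![u, v, w] := by rw [p2, p1, neg_neg]
  have p5 (u v w : V) : η ![w, v, u] = -η ![u, v, w] := by rw [p2, p3]
  have n3 (u v w : V) : η ![u, v, -w] = -η ![u, v, w] :=
    (congrArg η (by ext r; fin_cases r <;> rfl)).trans
      ((η.toAlternatingMap.map_update_neg ![u, v, w] 2 w).trans
        (congrArg (fun z ↦ -η z) (by ext r; fin_cases r <;> rfl)))
  have n2 (u v w : V) : η ![u, -v, w] = -η ![u, v, w] := by rw [p1, n3, p1 u v w, neg_neg]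
  have n1 (u v w : V) : η ![-u, v, w] = -η ![u, v, w] := by rw [p2, n2, p2 u v w, neg_neg]
  constructor
  · have e : volForm ξ ![a, s, l, n] = volForm ξ ![s, l, a, n] := by
      simp only [volForm_explicit]; ring
    rw [h2, sum_fin_three_fun]
    simp only [Fin.sum_univ_four, hcomp, Matrix.cons_val, z1, z2, z3, z4, z5, z6, mul_zero, zero_add,
      add_zero, n1, n2, n3]
    rw [t1 a s l n, t2 a s l n, t3 a s l n, t4 a s l n, t5 a s l n, e,
      p1 s l n, p2 s l n, p3 s l n, p4 s l n, p5 s l n]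
    ring
  · have e : volForm ξ ![l, s, a, n] = -volForm ξ ![s, l, a, n] := by
      simp only [volForm_explicit]; ring
    rw [h2, sum_fin_three_fun]
    simp only [Fin.sum_univ_four, hcomp, Matrix.cons_val, z1, z2, z3, z4, z5, z6, mul_zero, zero_add,
      add_zero, n1, n2, n3]
    rw [t1 l s a n, t2 l s a n, t3 l s a n, t4 l s a n, t5 l s a n, e,
      p1 s l a, p2 s l a, p3 s l a, p4 s l a, p5 s l a]
    ring

end IsNullTetrad

section Star

variable [IsTopologicalAddGroup V] [ContinuousSMul ℝ V]

/-- The coordinate formula for the Hodge star of a 2-form, in terms of the volume form. -/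
theorem IsDualPair.hodge_two {x xu : Fin 4 → V} {ξ : Fin 4 → (V →L[ℝ] ℝ)} (h : IsDualPair x ξ)
    (η : V [⋀^Fin 2]→L[ℝ] ℝ) (c : ℝ) (w : Fin 2 → V) :
    (∑ i : Fin 2 → Fin 4, ∑ j : Fin 2 → Fin 4,
      (((2 : ℕ).factorial : ℝ)⁻¹ * ((2 : ℕ).factorial : ℝ)⁻¹ * c * η (fun r ↦ xu (i r)) *
        permSymbol (Fin.append i j ∘ Fin.cast rfl)) • wedge (fun r ↦ ξ (j r))) w =
      c / 2 * ∑ i : Fin 2 → Fin 4, η (xu ∘ i) * volForm ξ ![w 0, w 1, x (i 0), x (i 1)] := by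
  rw [ContinuousAlternatingMap.sum_apply, Finset.mul_sum]
  refine Finset.sum_congr rfl fun i _ ↦ ?_
  have key : ∑ j : Fin 2 → Fin 4, permSymbol (Fin.append i j ∘ Fin.cast rfl) *
      wedge (fun r ↦ ξ (j r)) w = 2 * volForm ξ ![w 0, w 1, x (i 0), x (i 1)] := by
    rw [sum_fin_two_fun]
    have e1 (v v' : V) : ∑ c, ∑ d, ξ c v * ξ d v' * volForm ξ ![x (i 0), x (i 1), x c, x d] =
        volForm ξ ![x (i 0), x (i 1), v, v'] := by
      rw [← h.sum_volForm_slot_two]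
      refine Finset.sum_congr rfl fun c _ ↦ ?_
      rw [← h.sum_volForm_slot_three, Finset.mul_sum]
      exact Finset.sum_congr rfl fun d _ ↦ by ring
    have e2 : volForm ξ ![x (i 0), x (i 1), w 0, w 1] = volForm ξ ![w 0, w 1, x (i 0), x (i 1)] := by
      simp only [volForm_explicit]; ring
    have e3 : volForm ξ ![x (i 0), x (i 1), w 1, w 0] =
        -volForm ξ ![w 0, w 1, x (i 0), x (i 1)] := by
      simp only [volForm_explicit]; ring
    have e4 : 2 * volForm ξ ![w 0, w 1, x (i 0), x (i 1)] =
        volForm ξ ![x (i 0), x (i 1), w 0, w 1] - volForm ξ ![x (i 0), x (i 1), w 1, w 0] := by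
      rw [e2, e3]; ring
    rw [e4, ← e1, ← e1, ← Finset.sum_sub_distrib]
    refine Finset.sum_congr rfl fun c _ ↦ ?_
    rw [← Finset.sum_sub_distrib]
    refine Finset.sum_congr rfl fun d _ ↦ ?_
    rw [h.permSymbol_four, wedge_two_apply]
    change volForm ξ ![x (i 0), x (i 1), x c, x d] * (ξ c (w 0) * ξ d (w 1) - ξ c (w 1) * ξ d (w 0)) = _
    ring
  rw [show c / 2 * (η (xu ∘ i) * volForm ξ ![w 0, w 1, x (i 0), x (i 1)]) =
    c / 4 * η (xu ∘ i) * (2 * volForm ξ ![w 0, w 1, x (i 0), x (i 1)]) by ring, ← key,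
    ContinuousAlternatingMap.sum_apply, Finset.mul_sum]
  refine Finset.sum_congr rfl fun j _ ↦ ?_
  rw [ContinuousAlternatingMap.smul_apply, smul_eq_mul, Nat.factorial_two]
  change _ * _ * c * η (xu ∘ i) * _ * _ = _
  push_cast
  ring

/-- The coordinate formula for the Hodge star of a 3-form, in terms of the volume form. -/
theorem IsDualPair.hodge_three {x xu : Fin 4 → V} {ξ : Fin 4 → (V →L[ℝ] ℝ)} (h : IsDualPair x ξ)
    (η : V [⋀^Fin 3]→L[ℝ] ℝ) (c : ℝ) (w : Fin 1 → V) :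
    (∑ i : Fin 3 → Fin 4, ∑ j : Fin 1 → Fin 4,
      (((3 : ℕ).factorial : ℝ)⁻¹ * ((1 : ℕ).factorial : ℝ)⁻¹ * c * η (fun r ↦ xu (i r)) *
        permSymbol (Fin.append i j ∘ Fin.cast rfl)) • wedge (fun r ↦ ξ (j r))) w =
      -(c / 6) * ∑ i : Fin 3 → Fin 4,
        η (xu ∘ i) * volForm ξ ![w 0, x (i 0), x (i 1), x (i 2)] := by
  rw [ContinuousAlternatingMap.sum_apply, Finset.mul_sum]
  refine Finset.sum_congr rfl fun i _ ↦ ?_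
  have key : ∑ j : Fin 1 → Fin 4, permSymbol (Fin.append i j ∘ Fin.cast rfl) *
      wedge (fun r ↦ ξ (j r)) w = -volForm ξ ![w 0, x (i 0), x (i 1), x (i 2)] := by
    have e2 : -volForm ξ ![w 0, x (i 0), x (i 1), x (i 2)] =
        volForm ξ ![x (i 0), x (i 1), x (i 2), w 0] := by
      simp only [volForm_explicit]; ring
    rw [e2, ← h.sum_volForm_slot_three, ← (Equiv.funUnique (Fin 1) (Fin 4)).symm.sum_comp]
    refine Finset.sum_congr rfl fun d _ ↦ ?_
    rw [h.permSymbol_four, wedge_one_apply, mul_comm]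
    rfl
  rw [show -(c / 6) * (η (xu ∘ i) * volForm ξ ![w 0, x (i 0), x (i 1), x (i 2)]) =
    c / 6 * η (xu ∘ i) * (-volForm ξ ![w 0, x (i 0), x (i 1), x (i 2)]) by ring, ← key,
    ContinuousAlternatingMap.sum_apply, Finset.mul_sum]
  refine Finset.sum_congr rfl fun j _ ↦ ?_
  rw [ContinuousAlternatingMap.smul_apply, smul_eq_mul]
  change _ * _ * c * η (xu ∘ i) * _ * _ = _
  norm_num [Nat.factorial]
  ring

namespace IsNullTetrad

variable {B : V →L[ℝ] V →L[ℝ] ℝ} {s l a n : V} (h : IsNullTetrad B s l a n)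
  {x xu : Fin 4 → V} {ξ : Fin 4 → (V →L[ℝ] ℝ)}
include h

/-- The contraction of `φ α ∧ l♭` with the volume form is a multiple of `s♭ ∧ l♭`. -/
theorem hodge_two (hV : Module.finrank ℝ V = 4) (hd : IsDualPair x ξ)
    (hxu : ∀ i v, B (xu i) v = ξ i v) (η : V [⋀^Fin 2]→L[ℝ] ℝ) (φ : ℝ)
    (hη : η = φ • wedge ![B a, B l]) (v w : V) :
    ∑ i : Fin 2 → Fin 4, η (xu ∘ i) * volForm ξ ![v, w, x (i 0), x (i 1)] =
      2 * φ * volForm ξ ![s, l, a, n] * (B s v * B l w - B s w * B l v) := by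
  have h1 := h.sum_contract hV hd hxu η.toMultilinearMap
    (((volForm ξ).curryLeft v).curryLeft w).toMultilinearMap
  have h2 : ∑ i : Fin 2 → Fin 4, η (xu ∘ i) * volForm ξ ![v, w, x (i 0), x (i 1)] =
      ∑ p : Fin 2 → Fin 4, η (![s, -n, a, -l] ∘ p) *
        volForm ξ ![v, w, (![s, l, a, n] : Fin 4 → V) (p 0), (![s, l, a, n] : Fin 4 → V) (p 1)] := by
    have hQ (f : Fin 4 → V) (i : Fin 2 → Fin 4) :
        (((volForm ξ).curryLeft v).curryLeft w).toMultilinearMap (f ∘ i) =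
          volForm ξ ![v, w, f (i 0), f (i 1)] :=
      congrArg (volForm ξ) (by ext r; fin_cases r <;> rfl)
    simp only [hQ] at h1
    exact h1
  have h3 : volForm ξ ![v, w, a, l] =
      volForm ξ ![s, l, a, n] * (B s v * B l w - B s w * B l v) := by
    conv_lhs => rw [h.expand hV v, h.expand hV w]
    simp only [volForm_explicit, map_add, map_sub, map_smul, smul_eq_mul]
    ring
  rw [h2, sum_fin_two_fun]
  simp only [hη, ContinuousAlternatingMap.smul_apply, wedge_two_apply, Fin.sum_univ_four,
    Function.comp_apply, Matrix.cons_val, map_neg, h.symm a s, h.symm a l, h.symm a n, h.symm l n,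
    h.a_a, h.l_l, h.n_l, h.n_a, h.l_s, h.l_a, h.s_a, smul_eq_mul]
  have h4 : volForm ξ ![v, w, l, a] = - volForm ξ ![v, w, a, l] := by
    simp only [volForm_explicit]; ring
  simp only [h4, h3]
  ring

/-- `F_{ij} F^{ij} = 0` for `F = φ α ∧ l♭`. -/
theorem sum_mul_self_eq_zero (hV : Module.finrank ℝ V = 4) (hd : IsDualPair x ξ)
    (hxu : ∀ i v, B (xu i) v = ξ i v) (η : V [⋀^Fin 2]→L[ℝ] ℝ) (φ : ℝ)
    (hη : η = φ • wedge ![B a, B l]) :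
    ∑ i, ∑ j, η ![x i, x j] * η ![xu i, xu j] = 0 := by
  have h1 := h.sum_contract hV hd hxu η.toMultilinearMap η.toMultilinearMap
  rw [sum_fin_two_fun, sum_fin_two_fun] at h1
  have h2 : ∑ i, ∑ j, η ![x i, x j] * η ![xu i, xu j] =
      ∑ i, ∑ j, η (xu ∘ ![i, j]) * η (x ∘ ![i, j]) := by
    refine Finset.sum_congr rfl fun i _ ↦ Finset.sum_congr rfl fun j _ ↦ ?_
    rw [mul_comm]
    congr 2 <;> ext r <;> fin_cases r <;> rfl
  rw [h2]
  refine h1.trans ?_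
  change ∑ i, ∑ j, η (_ ∘ ![i, j]) * η (_ ∘ ![i, j]) = 0
  simp [hη, wedge_two_apply, Fin.sum_univ_four, h.symm a s, h.symm a l, h.symm a n, h.symm l n,
    h.a_a, h.l_l, h.n_l, h.n_a, h.l_s, h.l_a, h.s_a]

end IsNullTetrad

end Star

section TwoForm

variable [IsTopologicalAddGroup V] [ContinuousSMul ℝ V]

/-- A 2-form with two basis vectors in its kernel is a multiple of the wedge product of the other
two dual covectors. -/
theorem IsDualPair.two_form_eq {x : Fin 4 → V} {ξ : Fin 4 → (V →L[ℝ] ℝ)}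
    (h : IsDualPair x ξ) {η : V [⋀^Fin 2]→L[ℝ] ℝ} (h0 : ∀ w, η ![x 0, w] = 0)
    (h1 : ∀ w, η ![x 1, w] = 0) : η = η ![x 2, x 3] • wedge ![ξ 2, ξ 3] := by
  have hswap (v w : V) : η ![w, v] = -η ![v, w] :=
    (congrArg η (by ext r; fin_cases r <;> rfl)).trans
      (η.toAlternatingMap.map_swap ![v, w] (show (0 : Fin 2) ≠ 1 by decide))
  have hself (v : V) : η ![v, v] = 0 := by
    have := hswap v v
    linarith
  have hlin (v w : V) : η ![v, w] = ξ 2 v * η ![x 2, w] + ξ 3 v * η ![x 3, w] := by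
    have hu (z : V) : Function.update ![v, w] 0 z = ![z, w] := by
      ext1 r; fin_cases r <;> rfl
    have e1 := η.toAlternatingMap.map_update_sum Finset.univ 0 (fun i ↦ ξ i v • x i) ![v, w]
    rw [← h.expand v] at e1
    have e2 (c : ℝ) (z : V) : η ![c • z, w] = c * η ![z, w] := by
      have := η.toAlternatingMap.map_update_smul ![v, w] 0 c z
      simp only [hu] at this
      exact this
    simp only [hu] at e1
    refine e1.trans ?_
    change ∑ i, η ![ξ i v • x i, w] = _
    simp only [e2, Fin.sum_univ_four, h0, h1]
    ring
  ext v
  rw [ContinuousAlternatingMap.smul_apply, wedge_two_apply,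
    show v = ![v 0, v 1] by ext1 r; fin_cases r <;> rfl, hlin, hswap (v 1) (x 2),
    hswap (v 1) (x 3), hlin (v 1), hlin (v 1), hself, hself, hswap (x 2) (x 3)]
  simp only [Matrix.cons_val, smul_eq_mul]
  ring

end TwoForm

section Comp

variable [IsTopologicalAddGroup V] [ContinuousSMul ℝ V] {W : Type*} [AddCommGroup W] [Module ℝ W]
  [TopologicalSpace W] [IsTopologicalAddGroup W] [ContinuousSMul ℝ W]

theorem wedge_one_comp {θ : V →L[ℝ] ℝ} {θ' : W →L[ℝ] ℝ} {f : W → V} (hθ : ∀ v, θ (f v) = θ' v)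
    (v : Fin 1 → W) : wedge ![θ] (fun i ↦ f (v i)) = wedge ![θ'] v := by
  simp [wedge_one_apply, hθ]

theorem smul_wedge_two_comp {θ ζ : V →L[ℝ] ℝ} {θ' ζ' : W →L[ℝ] ℝ} {f : W → V}
    (hθ : ∀ v, θ (f v) = θ' v) (hζ : ∀ v, ζ (f v) = ζ' v) (c : ℝ) (v : Fin 2 → W) :
    (c • wedge ![θ, ζ]) (fun i ↦ f (v i)) = (c • wedge ![θ', ζ']) v := by
  simp [wedge_two_apply, hθ, hζ]

end Comp

namespace IsNullTetrad

variable {B : V →L[ℝ] V →L[ℝ] ℝ} {s l a n : V} (h : IsNullTetrad B s l a n)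
  {x : Fin 4 → V} {ξ : Fin 4 → (V →L[ℝ] ℝ)}
include h

theorem det_gram_ne_zero (hd : IsDualPair x ξ) :
    (Matrix.of fun i j ↦ B (x i) (x j)).det ≠ 0 := by
  rw [h.det_gram hd]
  exact neg_ne_zero.2 (pow_ne_zero 2 (h.det_flat_ne_zero hd))

theorem inner_up (hd : IsDualPair x ξ) (i : Fin 4) (v : V) :
    B (∑ j, (Matrix.of fun i j ↦ B (x i) (x j))⁻¹ i j • x j) v = ξ i v :=
  hd.inner_inv_gram (h.det_gram_ne_zero hd) i v

theorem inner_sharp (hd : IsDualPair x ξ) (θ : V [⋀^Fin 1]→L[ℝ] ℝ) (v : V) :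
    B v (∑ i, θ ![x i] • ∑ j, (Matrix.of fun i j ↦ B (x i) (x j))⁻¹ i j • x j) = θ ![v] := by
  rw [h.symm, map_sum, hd.apply_one]
  simp only [map_smul, sum_apply, smul_apply, smul_eq_mul]
  exact Finset.sum_congr rfl fun i _ ↦ congrArg (_ * ·) (h.inner_up hd i v)

variable [IsTopologicalAddGroup V] [ContinuousSMul ℝ V]

/-- The Hodge dual of a multiple of `α ∧ l♭` is, up to sign, the same multiple of `s♭ ∧ l♭`. -/
theorem hodge_two_eq (hV : Module.finrank ℝ V = 4) (hd : IsDualPair x ξ)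
    (η : V [⋀^Fin 2]→L[ℝ] ℝ) (φ : ℝ) (hη : η = φ • wedge ![B a, B l]) :
    (∑ i : Fin 2 → Fin 4, ∑ j : Fin 2 → Fin 4,
      (((2 : ℕ).factorial : ℝ)⁻¹ * ((2 : ℕ).factorial : ℝ)⁻¹ *
        √|(Matrix.of fun i j ↦ B (x i) (x j)).det| *
        η (fun r ↦ ∑ j, (Matrix.of fun i j ↦ B (x i) (x j))⁻¹ (i r) j • x j) *
        permSymbol (Fin.append i j ∘ Fin.cast rfl)) • wedge (fun r ↦ ξ (j r))) =
      (-(SignType.sign (Matrix.of fun r i ↦ B (![s, l, a, n] r) (x i)).det : ℝ) * φ) •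
        wedge ![B s, B l] := by
  ext w
  refine (hd.hodge_two
    (xu := fun i ↦ ∑ j, (Matrix.of fun i j ↦ B (x i) (x j))⁻¹ i j • x j) η _ w).trans ?_
  rw [h.hodge_two hV hd (h.inner_up hd) η φ hη, ← h.sqrt_mul_volForm hd,
    ContinuousAlternatingMap.smul_apply, wedge_two_apply]
  simp only [Matrix.cons_val, smul_eq_mul]
  ring

/-- The components of `*η` along `α♯` and `l`, for a 3-form `η`, are those of `η` on the
remaining frame vectors, up to a nonzero factor. -/
theorem hodge_three_eq_zero_iff (hV : Module.finrank ℝ V = 4) (hd : IsDualPair x ξ)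
    (η : V [⋀^Fin 3]→L[ℝ] ℝ) {θ : V [⋀^Fin 1]→L[ℝ] ℝ}
    (hθ : θ = ∑ i : Fin 3 → Fin 4, ∑ j : Fin 1 → Fin 4,
      (((3 : ℕ).factorial : ℝ)⁻¹ * ((1 : ℕ).factorial : ℝ)⁻¹ *
        √|(Matrix.of fun i j ↦ B (x i) (x j)).det| *
        η (fun r ↦ ∑ j, (Matrix.of fun i j ↦ B (x i) (x j))⁻¹ (i r) j • x j) *
        permSymbol (Fin.append i j ∘ Fin.cast rfl)) • wedge (fun r ↦ ξ (j r))) :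
    (θ ![a] = 0 ↔ η ![s, l, n] = 0) ∧ (θ ![l] = 0 ↔ η ![s, l, a] = 0) := by
  have h1 (w : Fin 1 → V) := (congrArg (fun θ' ↦ θ' w) hθ).trans (hd.hodge_three
    (xu := fun i ↦ ∑ j, (Matrix.of fun i j ↦ B (x i) (x j))⁻¹ i j • x j) η _ w)
  obtain ⟨h2, h3⟩ := h.hodge_three hV hd (h.inner_up hd) η
  have h4 : √|(Matrix.of fun i j ↦ B (x i) (x j)).det| ≠ 0 :=
    Real.sqrt_ne_zero'.2 (abs_pos.2 (h.det_gram_ne_zero hd))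
  have h5 := h.volForm_ne_zero hd
  have h6 := h1 ![a]
  have h7 := h1 ![l]
  simp only [Matrix.cons_val_fin_one] at h6 h7
  rw [h6, h7, h2, h3]
  simp [h4, h5]

/-- If `ω = φ α ∧ l♭` with `φ ≠ 0`, then a vector is in the kernel of `ω` if and only if it is
orthogonal to `α♯` and to `l`. -/
theorem smul_wedge_apply_eq_zero_iff {φ : ℝ} (hφ : φ ≠ 0) (v : V) :
    (∀ w, (φ • wedge ![B a, B l]) ![v, w] = 0) ↔ B a v = 0 ∧ B l v = 0 := by
  simp only [ContinuousAlternatingMap.smul_apply, wedge_two_apply, Matrix.cons_val, smul_eq_mul,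
    mul_eq_zero, hφ, false_or]
  constructor
  · intro H
    have e1 := H a
    have e2 := H n
    rw [h.l_a, h.a_a] at e1
    rw [h.symm a n, h.n_a, h.symm l n, h.n_l] at e2
    exact ⟨by linarith, by linarith⟩
  · rintro ⟨h1, h2⟩ w
    rw [h1, h2]; ring

end IsNullTetrad

end Pointwise

/-! ### Exterior derivatives on `ℝ⁴` -/

theorem E4.expand (v : E4) : v = ∑ i, v i • EuclideanSpace.single i (1 : ℝ) := by
  ext j
  simp [Finset.sum_apply, Pi.single_apply]

theorem covector_eq_sum (θ : E4 →L[ℝ] ℝ) :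
    θ = ∑ i, θ (EuclideanSpace.single i 1) • (EuclideanSpace.proj i : E4 →L[ℝ] ℝ) := by
  ext v
  conv_lhs => rw [E4.expand v]
  simp [mul_comm]

/-- Expansions in the constant forms `dxⁱ` and `dxⁱ ∧ dxʲ` exhibit a form with smooth coefficients
as a smooth map into the space of alternating maps. -/
theorem wedge_one_eq_sum (θ : E4 →L[ℝ] ℝ) :
    wedge ![θ] = ∑ i, θ (EuclideanSpace.single i 1) •
      wedge ![(EuclideanSpace.proj i : E4 →L[ℝ] ℝ)] := by
  ext v
  simp only [ContinuousAlternatingMap.sum_apply, ContinuousAlternatingMap.smul_apply,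
    wedge_one_apply, Matrix.cons_val]
  conv_lhs => rw [covector_eq_sum θ]
  simp

theorem wedge_two_eq_sum (θ ζ : E4 →L[ℝ] ℝ) :
    wedge ![θ, ζ] = ∑ i, ∑ j, (θ (EuclideanSpace.single i 1) * ζ (EuclideanSpace.single j 1)) •
      wedge ![(EuclideanSpace.proj i : E4 →L[ℝ] ℝ), (EuclideanSpace.proj j : E4 →L[ℝ] ℝ)] := by
  ext v
  simp only [ContinuousAlternatingMap.sum_apply, ContinuousAlternatingMap.smul_apply,
    wedge_two_apply, Matrix.cons_val]
  conv_lhs => rw [covector_eq_sum θ, covector_eq_sum ζ]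
  simp only [sum_apply, smul_apply, Finset.sum_mul_sum,
    ← Finset.sum_sub_distrib, smul_eq_mul]
  exact Finset.sum_congr rfl fun i _ ↦ Finset.sum_congr rfl fun j _ ↦ by ring

theorem extDeriv_wedge_one {θ : E4 → (E4 →L[ℝ] ℝ)} {x : E4} (hθ : DifferentiableAt ℝ θ x)
    (v w : E4) : extDeriv (fun y ↦ wedge ![θ y]) x ![v, w] = fderiv ℝ θ x v w - fderiv ℝ θ x w v := by
  have hd : DifferentiableAt ℝ (fun y ↦ wedge ![θ y]) x := by
    simp_rw [wedge_one_eq_sum (θ _)]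
    fun_prop
  rw [extDeriv_apply hd]
  have h1 (v : Fin 1 → E4) (w : E4) :
      fderiv ℝ (fun y ↦ wedge ![θ y] v) x w = fderiv ℝ θ x w (v 0) := by
    simp only [wedge_one_apply, Matrix.cons_val]
    rw [fderiv_clm_apply hθ (differentiableAt_const _)]
    simp
  simp [Fin.sum_univ_succ, h1, Fin.removeNth, sub_eq_add_neg]

/-- `d(φ θ ∧ ζ) = dφ ∧ θ ∧ ζ + φ dθ ∧ ζ - φ θ ∧ dζ`, evaluated on three vectors. -/
theorem extDeriv_smul_wedge_two {φ : E4 → ℝ} {θ ζ : E4 → (E4 →L[ℝ] ℝ)} {x : E4}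
    (hφ : DifferentiableAt ℝ φ x) (hθ : DifferentiableAt ℝ θ x) (hζ : DifferentiableAt ℝ ζ x)
    (u v w : E4) :
    extDeriv (fun y ↦ φ y • wedge ![θ y, ζ y]) x ![u, v, w] =
      fderiv ℝ φ x u * (θ x v * ζ x w - θ x w * ζ x v)
      - fderiv ℝ φ x v * (θ x u * ζ x w - θ x w * ζ x u)
      + fderiv ℝ φ x w * (θ x u * ζ x v - θ x v * ζ x u)
      + φ x * ((fderiv ℝ θ x u v - fderiv ℝ θ x v u) * ζ x w
        - (fderiv ℝ θ x u w - fderiv ℝ θ x w u) * ζ x v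
        + (fderiv ℝ θ x v w - fderiv ℝ θ x w v) * ζ x u)
      - φ x * ((fderiv ℝ ζ x u v - fderiv ℝ ζ x v u) * θ x w
        - (fderiv ℝ ζ x u w - fderiv ℝ ζ x w u) * θ x v
        + (fderiv ℝ ζ x v w - fderiv ℝ ζ x w v) * θ x u) := by
  have hd : DifferentiableAt ℝ (fun y ↦ φ y • wedge ![θ y, ζ y]) x := by
    simp_rw [wedge_two_eq_sum (θ _)]
    fun_prop
  rw [extDeriv_apply hd]
  have h1 (v : Fin 2 → E4) (w : E4) :
      fderiv ℝ (fun y ↦ (φ y • wedge ![θ y, ζ y]) v) x w =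
        fderiv ℝ φ x w * (θ x (v 0) * ζ x (v 1) - θ x (v 1) * ζ x (v 0)) +
        φ x * (fderiv ℝ θ x w (v 0) * ζ x (v 1) + θ x (v 0) * fderiv ℝ ζ x w (v 1)
          - fderiv ℝ θ x w (v 1) * ζ x (v 0) - θ x (v 1) * fderiv ℝ ζ x w (v 0)) := by
    simp only [ContinuousAlternatingMap.smul_apply, wedge_two_apply, Matrix.cons_val, smul_eq_mul]
    have e (θ : E4 → (E4 →L[ℝ] ℝ)) (hθ : DifferentiableAt ℝ θ x) (z : E4) :
        HasFDerivAt (fun y ↦ θ y z) ((fderiv ℝ θ x).flip z) x := by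
      simpa using hθ.hasFDerivAt.clm_apply (hasFDerivAt_const z x)
    have := hφ.hasFDerivAt.mul (((e θ hθ (v 0)).mul (e ζ hζ (v 1))).sub
      ((e θ hθ (v 1)).mul (e ζ hζ (v 0))))
    have h2 := this.fderiv
    simp only [Pi.mul_def, Pi.sub_def] at h2
    rw [h2]
    simp
    ring
  have r0 : Fin.removeNth 0 ![u, v, w] = ![v, w] := by ext1 r; fin_cases r <;> rfl
  have r1 : Fin.removeNth 1 ![u, v, w] = ![u, w] := by ext1 r; fin_cases r <;> rfl
  have r2 : Fin.removeNth 2 ![u, v, w] = ![u, v] := by ext1 r; fin_cases r <;> rfl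
  rw [Fin.sum_univ_three, h1, h1, h1, r0, r1, r2]
  simp
  ring

/-- A function of `(x³, x⁴)` has no derivative along the slices. -/
theorem fderiv_eq_zero_of_const_on_slices {U : Set E4} (hU : IsOpen U) {f : E4 → ℝ}
    (hf : ∀ y ∈ U, ∀ y' ∈ U, y 2 = y' 2 → y 3 = y' 3 → f y = f y') {y : E4} (hy : y ∈ U)
    (hd : DifferentiableAt ℝ f y) {v : E4} (h2 : v 2 = 0) (h3 : v 3 = 0) :
    fderiv ℝ f y v = 0 := by
  have h1 : HasDerivAt (fun t : ℝ ↦ f (y + t • v)) (fderiv ℝ f y v) 0 :=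
    hd.hasFDerivAt.hasLineDerivAt v
  have hc : ContinuousAt (fun t : ℝ ↦ y + t • v) 0 := by fun_prop
  have h4 : ∀ᶠ t in 𝓝 (0 : ℝ), y + t • v ∈ U :=
    hc.eventually_mem (hU.mem_nhds (by simpa using hy))
  have h5 : HasDerivAt (fun t : ℝ ↦ f (y + t • v)) 0 0 := by
    refine (hasDerivAt_const 0 (f y)).congr_of_eventuallyEq ?_
    filter_upwards [h4] with t ht
    exact hf _ ht _ hy (by simp [h2]) (by simp [h3])
  exact h1.unique h5

/-- A function whose derivatives along the slices vanish is constant on each slice, because the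
slices are connected. -/
theorem const_on_slices_of_fderiv_eq_zero {U : Set E4} (hU : IsOpen U)
    (hslice : ∀ c d : ℝ, IsPreconnected {y ∈ U | y 2 = c ∧ y 3 = d}) {f : E4 → ℝ}
    (hd : DifferentiableOn ℝ f U)
    (h0 : ∀ y ∈ U, fderiv ℝ f y (EuclideanSpace.single 0 1) = 0)
    (h1 : ∀ y ∈ U, fderiv ℝ f y (EuclideanSpace.single 1 1) = 0)
    {y y' : E4} (hy : y ∈ U) (hy' : y' ∈ U) (h2 : y 2 = y' 2) (h3 : y 3 = y' 3) :
    f y = f y' := by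
  -- the slice through `y`, parametrized by the first two coordinates
  set A : ℝ × ℝ →L[ℝ] E4 :=
    (ContinuousLinearMap.fst ℝ ℝ ℝ).smulRight (EuclideanSpace.single 0 1) +
    (ContinuousLinearMap.snd ℝ ℝ ℝ).smulRight (EuclideanSpace.single 1 1) with hA
  set ι : ℝ × ℝ → E4 := fun p ↦ A p +
    (y 2 • EuclideanSpace.single 2 1 + y 3 • EuclideanSpace.single 3 1) with hι
  have hι1 (z : E4) (e2 : z 2 = y 2) (e3 : z 3 = y 3) : ι (z 0, z 1) = z := by
    conv_rhs => rw [E4.expand z, Fin.sum_univ_four, e2, e3]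
    simp only [hι, hA, add_apply, ContinuousLinearMap.smulRight_apply, ContinuousLinearMap.coe_fst',
      ContinuousLinearMap.coe_snd']
    abel
  have hιd (p : ℝ × ℝ) : HasFDerivAt ι A p := A.hasFDerivAt.add_const _
  have hιc : Continuous ι := by fun_prop
  have hO : IsOpen (ι ⁻¹' U) := hU.preimage hιc
  have hOc : IsPreconnected (ι ⁻¹' U) := by
    have : ι ⁻¹' U = (fun z : E4 ↦ (z 0, z 1)) '' {z ∈ U | z 2 = y 2 ∧ z 3 = y 3} := by
      ext p
      constructor
      · intro hp
        exact ⟨ι p, ⟨hp, by simp [hι, hA], by simp [hι, hA]⟩, by ext <;> simp [hι, hA]⟩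
      · rintro ⟨z, ⟨hz, e2, e3⟩, rfl⟩
        rw [Set.mem_preimage, hι1 z e2 e3]
        exact hz
    rw [this]
    exact (hslice _ _).image _ (by fun_prop)
  have hfd (p : ℝ × ℝ) (hp : p ∈ ι ⁻¹' U) :
      HasFDerivAt (fun p ↦ f (ι p)) ((fderiv ℝ f (ι p)).comp A) p :=
    (hd.differentiableAt (hU.mem_nhds hp)).hasFDerivAt.comp p (hιd p)
  have key := hO.is_const_of_fderiv_eq_zero (𝕜 := ℝ) (f := fun p ↦ f (ι p)) hOc
    (fun p hp ↦ (hfd p hp).differentiableAt.differentiableWithinAt)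
    (fun p hp ↦ by
      rw [(hfd p hp).fderiv]
      ext <;> simp [hA, h0 _ hp, h1 _ hp])
    (x := (y 0, y 1)) (y := (y' 0, y' 1))
    (by rwa [Set.mem_preimage, hι1 y rfl rfl]) (by rwa [Set.mem_preimage, hι1 y' h2.symm h3.symm])
  simpa only [hι1 y rfl rfl, hι1 y' h2.symm h3.symm] using key

/-- The form `f dx³ ∧ dx⁴` on `ℝ⁴`. -/
def transverseForm (f : E4 → ℝ) (y : E4) : E4 [⋀^Fin 2]→L[ℝ] ℝ :=
  f y • wedge ![(EuclideanSpace.proj 2 : E4 →L[ℝ] ℝ), (EuclideanSpace.proj 3 : E4 →L[ℝ] ℝ)]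

theorem extDeriv_transverseForm {f : E4 → ℝ} {y : E4} (hf : DifferentiableAt ℝ f y) (u v w : E4) :
    extDeriv (transverseForm f) y ![u, v, w] =
      fderiv ℝ f y u * (v 2 * w 3 - w 2 * v 3) - fderiv ℝ f y v * (u 2 * w 3 - w 2 * u 3) +
        fderiv ℝ f y w * (u 2 * v 3 - v 2 * u 3) := by
  refine (extDeriv_smul_wedge_two hf (differentiableAt_const _) (differentiableAt_const _)
    u v w).trans ?_
  simp

theorem extDeriv_transverseForm_eq_zero {U : Set E4} (hU : IsOpen U) {f : E4 → ℝ}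
    (hf : ∀ y ∈ U, ∀ y' ∈ U, y 2 = y' 2 → y 3 = y' 3 → f y = f y') {y : E4} (hy : y ∈ U)
    (hd : DifferentiableAt ℝ f y) : extDeriv (transverseForm f) y = 0 := by
  have h1 (v : E4) : fderiv ℝ f y v = v 2 * fderiv ℝ f y (EuclideanSpace.single 2 1) +
      v 3 * fderiv ℝ f y (EuclideanSpace.single 3 1) := by
    conv_lhs => rw [E4.expand v]
    rw [Fin.sum_univ_four]
    simp [fderiv_eq_zero_of_const_on_slices hU hf hy hd]
  ext v
  have h2 : v = ![v 0, v 1, v 2] := by ext1 r; fin_cases r <;> rfl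
  rw [h2, extDeriv_transverseForm hd, h1 (v 0), h1 (v 1), h1 (v 2)]
  change _ = (0 : ℝ)
  ring

/-! ### Charts -/

section Chart

variable {M : Type*} [TopologicalSpace M] [ChartedSpace E4 M] {e : OpenPartialHomeomorph M E4}
  {𝓕 : Foliation M} {F : Form M 2} {u : M → ℝ}

theorem mdifferentiable_of_mem_maximalAtlas (he : e ∈ IsManifold.maximalAtlas 𝓘(ℝ, E4) ∞ M) :
    e.MDifferentiable 𝓘(ℝ, E4) 𝓘(ℝ, E4) :=
  ⟨(contMDiffOn_of_mem_maximalAtlas he).mdifferentiableOn (by simp),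
    (contMDiffOn_symm_of_mem_maximalAtlas he).mdifferentiableOn (by simp)⟩

theorem mfderiv_mfderiv_symm (he : e ∈ IsManifold.maximalAtlas 𝓘(ℝ, E4) ∞ M) {q : M}
    (hq : q ∈ e.source) (v : E4) :
    (mfderiv 𝓘(ℝ, E4) 𝓘(ℝ, E4) e q (mfderiv 𝓘(ℝ, E4) 𝓘(ℝ, E4) e.symm (e q) v) : E4) = v := by
  have h := (mdifferentiable_of_mem_maximalAtlas he).comp_symm_deriv (e.map_source hq)
  rw [e.left_inv hq] at h
  exact DFunLike.congr_fun h v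

theorem mfderiv_symm_mfderiv (he : e ∈ IsManifold.maximalAtlas 𝓘(ℝ, E4) ∞ M) {q : M}
    (hq : q ∈ e.source) (v : TangentSpace 𝓘(ℝ, E4) q) :
    (mfderiv 𝓘(ℝ, E4) 𝓘(ℝ, E4) e.symm (e q) (mfderiv 𝓘(ℝ, E4) 𝓘(ℝ, E4) e q v) : E4) = v :=
  DFunLike.congr_fun ((mdifferentiable_of_mem_maximalAtlas he).symm_comp_deriv hq) v

theorem isDualPair_coord (he : e ∈ IsManifold.maximalAtlas 𝓘(ℝ, E4) ∞ M) {q : M}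
    (hq : q ∈ e.source) : IsDualPair (fun i ↦ coordVec e i q) (fun i ↦ coordForm e i q) where
  dual i j := by
    have := congrArg (fun z : E4 ↦ z i) (mfderiv_mfderiv_symm he hq (EuclideanSpace.single j 1))
    refine this.trans ?_
    simp
  expand v := by
    have h1 := mfderiv_symm_mfderiv he hq v
    refine h1.symm.trans ?_
    have h2 := E4.expand (mfderiv 𝓘(ℝ, E4) 𝓘(ℝ, E4) e q v)
    refine (congrArg (fun z : E4 ↦ (mfderiv 𝓘(ℝ, E4) 𝓘(ℝ, E4) e.symm (e q) z : E4)) h2).trans ?_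
    exact (map_sum (mfderiv 𝓘(ℝ, E4) 𝓘(ℝ, E4) e.symm (e q)) _ _).trans
      (Finset.sum_congr rfl fun i _ ↦ map_smul (mfderiv 𝓘(ℝ, E4) 𝓘(ℝ, E4) e.symm (e q)) _ _)

theorem finrank_tangentSpace (q : M) : Module.finrank ℝ (TangentSpace 𝓘(ℝ, E4) q) = 4 :=
  finrank_euclideanSpace_fin (𝕜 := ℝ) (n := 4)

theorem extD_apply {k : ℕ} (η : Form M k) (q : M)
    (v : Fin (k + 1) → TangentSpace 𝓘(ℝ, E4) q) :
    extD e η q v = extDeriv (coordRep e η) (e q)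
      fun i ↦ (mfderiv 𝓘(ℝ, E4) 𝓘(ℝ, E4) e q (v i) : E4) := rfl

theorem extD_apply_two (η : Form M 1) (q : M) (v w : TangentSpace 𝓘(ℝ, E4) q) :
    extD e η q ![v, w] = extDeriv (coordRep e η) (e q)
      ![(mfderiv 𝓘(ℝ, E4) 𝓘(ℝ, E4) e q v : E4), (mfderiv 𝓘(ℝ, E4) 𝓘(ℝ, E4) e q w : E4)] := by
  rw [extD_apply]
  congr 1; ext1 i; fin_cases i <;> rfl

theorem extD_apply_three (η : Form M 2) (q : M) (u v w : TangentSpace 𝓘(ℝ, E4) q) :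
    extD e η q ![u, v, w] = extDeriv (coordRep e η) (e q)
      ![(mfderiv 𝓘(ℝ, E4) 𝓘(ℝ, E4) e q u : E4), (mfderiv 𝓘(ℝ, E4) 𝓘(ℝ, E4) e q v : E4),
        (mfderiv 𝓘(ℝ, E4) 𝓘(ℝ, E4) e q w : E4)] := by
  rw [extD_apply]
  congr 1; ext1 i; fin_cases i <;> rfl

theorem coordRep_smul_wedge_coordForm (he : e ∈ IsManifold.maximalAtlas 𝓘(ℝ, E4) ∞ M)
    {η : Form M 2} {y : E4} (hy : y ∈ e.target) {c : ℝ} {i j : Fin 4}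
    (h : η (e.symm y) = c • wedge ![coordForm e i (e.symm y), coordForm e j (e.symm y)]) :
    coordRep e η y = c • wedge ![(EuclideanSpace.proj i : E4 →L[ℝ] ℝ),
      (EuclideanSpace.proj j : E4 →L[ℝ] ℝ)] := by
  have h1 (i : Fin 4) (v : E4) :
      coordForm e i (e.symm y) (mfderiv 𝓘(ℝ, E4) 𝓘(ℝ, E4) e.symm y v) = v i := by
    have := (mdifferentiable_of_mem_maximalAtlas he).comp_symm_deriv hy
    exact congrArg (fun z : E4 ↦ z i) (DFunLike.congr_fun this v)
  ext v
  exact (DFunLike.congr_fun h _).trans (smul_wedge_two_comp (h1 i) (h1 j) c v)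

theorem coordRep_eq_transverseForm (he : e ∈ IsManifold.maximalAtlas 𝓘(ℝ, E4) ∞ M)
    (hF : ∀ q ∈ e.source, F q = u q • wedge ![coordForm e 2 q, coordForm e 3 q]) {y : E4}
    (hy : y ∈ e.target) : coordRep e F y = transverseForm (fun y ↦ u (e.symm y)) y :=
  coordRep_smul_wedge_coordForm he hy (hF _ (e.map_target hy))

theorem contDiffOn_comp_symm (he : e ∈ IsManifold.maximalAtlas 𝓘(ℝ, E4) ∞ M)
    (hu : ContMDiffOn 𝓘(ℝ, E4) 𝓘(ℝ, ℝ) ∞ u e.source) :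
    ContDiffOn ℝ ∞ (fun y ↦ u (e.symm y)) e.target := by
  rw [← contMDiffOn_iff_contDiffOn]
  exact hu.comp (contMDiffOn_symm_of_mem_maximalAtlas he) fun y hy ↦ e.map_target hy

theorem isLeafFunction_one : IsLeafFunction e (fun _ ↦ 1) :=
  ⟨contMDiffOn_const, fun _ _ _ _ _ _ ↦ rfl⟩

theorem IsLeafFunction.differentiableAt (he : e ∈ IsManifold.maximalAtlas 𝓘(ℝ, E4) ∞ M)
    (hu : IsLeafFunction e u) {y : E4} (hy : y ∈ e.target) :
    DifferentiableAt ℝ (fun y ↦ u (e.symm y)) y :=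
  ((contDiffOn_comp_symm he hu.smooth).contDiffAt (e.open_target.mem_nhds hy)).differentiableAt
    (by simp)

theorem IsLeafFunction.isSmoothForm (he : e ∈ IsManifold.maximalAtlas 𝓘(ℝ, E4) ∞ M)
    (hu : IsLeafFunction e u)
    (hF : ∀ q ∈ e.source, F q = u q • wedge ![coordForm e 2 q, coordForm e 3 q]) :
    IsSmoothForm e F :=
  ((contDiffOn_comp_symm he hu.smooth).smul contDiffOn_const).congr
    fun _ hy ↦ coordRep_eq_transverseForm he hF hy

theorem IsLeafFunction.extDeriv_coordRep (he : e ∈ IsManifold.maximalAtlas 𝓘(ℝ, E4) ∞ M)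
    (hu : IsLeafFunction e u)
    (hF : ∀ q ∈ e.source, F q = u q • wedge ![coordForm e 2 q, coordForm e 3 q]) {y : E4}
    (hy : y ∈ e.target) : extDeriv (coordRep e F) y = 0 := by
  have h1 : coordRep e F =ᶠ[𝓝 y] transverseForm (fun y ↦ u (e.symm y)) := by
    filter_upwards [e.open_target.mem_nhds hy] with z hz using coordRep_eq_transverseForm he hF hz
  rw [h1.extDeriv_eq]
  refine extDeriv_transverseForm_eq_zero e.open_target (fun z hz z' hz' h2 h3 ↦ ?_) hy
    (hu.differentiableAt he hy)
  exact hu.const _ (e.map_target hz) _ (e.map_target hz') (by simpa [hz, hz'] using h2)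
    (by simpa [hz, hz'] using h3)

/-- A closed form `u dx³ ∧ dx⁴` has `u = u(x³, x⁴)`. -/
theorem isLeafFunction_of_closed (he : IsFlatChart 𝓕.leaves e)
    (hF : ∀ q ∈ e.source, F q = u q • wedge ![coordForm e 2 q, coordForm e 3 q])
    (hs : IsSmoothForm e F) (hc : ∀ q ∈ e.source, extD e F q = 0) : IsLeafFunction e u := by
  have hm := he.mem_maximalAtlas
  have hu : ContDiffOn ℝ ∞ (fun y ↦ u (e.symm y)) e.target := by
    have h1 : ContDiffOn ℝ ∞ (fun y ↦ coordRep e F y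
        ![EuclideanSpace.single 2 1, EuclideanSpace.single 3 1]) e.target :=
      (ContinuousAlternatingMap.apply ℝ E4 ℝ
        ![EuclideanSpace.single 2 1, EuclideanSpace.single 3 1]).contDiff.comp_contDiffOn hs
    refine h1.congr fun y hy ↦ ?_
    rw [coordRep_eq_transverseForm hm hF hy, transverseForm, ContinuousAlternatingMap.smul_apply,
      wedge_two_apply]
    simp
  have hd : ∀ y ∈ e.target, DifferentiableAt ℝ (fun y ↦ u (e.symm y)) y := fun y hy ↦
    (hu.contDiffAt (e.open_target.mem_nhds hy)).differentiableAt (by simp)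
  have hc' : ∀ y ∈ e.target, ∀ v : Fin 3 → E4,
      extDeriv (transverseForm fun y ↦ u (e.symm y)) y v = 0 := fun y hy v ↦ by
    have h1 : coordRep e F =ᶠ[𝓝 y] transverseForm (fun y ↦ u (e.symm y)) := by
      filter_upwards [e.open_target.mem_nhds hy] with z hz using coordRep_eq_transverseForm hm hF hz
    rw [← h1.extDeriv_eq]
    have h2 : extDeriv (coordRep e F) (e (e.symm y)) (fun i ↦ (mfderiv 𝓘(ℝ, E4) 𝓘(ℝ, E4) e
        (e.symm y) (mfderiv 𝓘(ℝ, E4) 𝓘(ℝ, E4) e.symm (e (e.symm y)) (v i)) : E4)) = 0 :=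
      DFunLike.congr_fun (hc (e.symm y) (e.map_target hy))
        (fun i ↦ mfderiv 𝓘(ℝ, E4) 𝓘(ℝ, E4) e.symm (e (e.symm y)) (v i))
    have h3 : (fun i ↦ (mfderiv 𝓘(ℝ, E4) 𝓘(ℝ, E4) e (e.symm y)
        (mfderiv 𝓘(ℝ, E4) 𝓘(ℝ, E4) e.symm (e (e.symm y)) (v i)) : E4)) = v :=
      funext fun i ↦ mfderiv_mfderiv_symm hm (e.map_target hy) (v i)
    rw [h3, e.right_inv hy] at h2
    exact h2
  refine ⟨?_, fun q hq q' hq' h2 h3 ↦ ?_⟩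
  · have h1 := hu.contMDiffOn.comp (contMDiffOn_of_mem_maximalAtlas hm) (fun q hq ↦ e.map_source hq)
    exact h1.congr fun q hq ↦ by simp [hq]
  · have h1 := const_on_slices_of_fderiv_eq_zero e.open_target he.slice_connected
      (f := fun y ↦ u (e.symm y)) (fun y hy ↦ (hd y hy).differentiableWithinAt)
      (fun y hy ↦ by
        have := hc' y hy ![EuclideanSpace.single 0 1, EuclideanSpace.single 2 1,
          EuclideanSpace.single 3 1]
        rw [extDeriv_transverseForm (hd y hy)] at this
        simpa using this)
      (fun y hy ↦ by
        have := hc' y hy ![EuclideanSpace.single 1 1, EuclideanSpace.single 2 1,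
          EuclideanSpace.single 3 1]
        rw [extDeriv_transverseForm (hd y hy)] at this
        simpa using this)
      (e.map_source hq) (e.map_source hq') h2 h3
    simpa [hq, hq'] using h1

end Chart

variable {M : Type*} [TopologicalSpace M] [ChartedSpace E4 M] [IsManifold 𝓘(ℝ, E4) ∞ M]
  {e : OpenPartialHomeomorph M E4} {g : LorentzMetric M} {𝓕 : Foliation M}
  {s l a n : (q : M) → TangentSpace 𝓘(ℝ, E4) q} {F : Form M 2} {u : M → ℝ}

/-- A curve that stays in a leaf stays, in a flat chart, in a single slice: a connected subset of
a countable set is a point. -/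
theorem IsFlatChart.coordForm_eq_zero {𝓕 : Foliation M} {e : OpenPartialHomeomorph M E4}
    (he : IsFlatChart 𝓕.leaves e) {q : M} (hq : q ∈ e.source) {v : TangentSpace 𝓘(ℝ, E4) q}
    (hv : v ∈ 𝓕.tangent q) : coordForm e 2 q v = 0 ∧ coordForm e 3 q v = 0 := by
  obtain ⟨L, hL, γ, hγ, hγL, hγv⟩ := hv
  obtain ⟨C, hC, hLC⟩ := he.leaf_inter L hL
  obtain ⟨h1, h2⟩ := Bundle.TotalSpace.mk.inj hγv
  subst h1
  obtain rfl := eq_of_heq h2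
  have hγ1 : ∀ᶠ t in 𝓝 (0 : ℝ), ContMDiffAt 𝓘(ℝ, ℝ) 𝓘(ℝ, E4) 1 γ t :=
    (contMDiffAt_iff_contMDiffAt_nhds (n := 1) (by simp)).1
      (hγ.of_le (WithTop.coe_le_coe.2 le_top))
  have hγs : ∀ᶠ t in 𝓝 (0 : ℝ), γ t ∈ e.source :=
    hγ.continuousAt.eventually_mem (e.open_source.mem_nhds hq)
  obtain ⟨ε, hε, hball⟩ := Metric.eventually_nhds_iff_ball.1 (hγ1.and (hγL.and hγs))
  have hsub : ((fun t ↦ ((e (γ t)) 2, (e (γ t)) 3)) '' Metric.ball 0 ε).Subsingleton := by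
    refine hC.isTotallyDisconnected _ ?_ ?_
    · rintro _ ⟨t, ht, rfl⟩
      have : γ t ∈ L ∩ e.source := (hball t ht).2
      rw [hLC] at this
      exact this.2
    · refine (convex_ball _ _).isPreconnected.image _ fun t ht ↦ ContinuousAt.continuousWithinAt ?_
      have hc : ContinuousAt (fun t ↦ e (γ t)) t :=
        (e.continuousAt (hball t ht).2.2).comp (hball t ht).1.continuousAt
      exact ((EuclideanSpace.proj (2 : Fin 4) : E4 →L[ℝ] ℝ).continuous.continuousAt.comp hc).prodMk
        ((EuclideanSpace.proj (3 : Fin 4) : E4 →L[ℝ] ℝ).continuous.continuousAt.comp hc)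
  have hconst (t : ℝ) (ht : t ∈ Metric.ball (0 : ℝ) ε) :
      (e (γ t)) 2 = (e (γ 0)) 2 ∧ (e (γ t)) 3 = (e (γ 0)) 3 :=
    Prod.mk.inj (hsub ⟨t, ht, rfl⟩ ⟨0, Metric.mem_ball_self hε, rfl⟩)
  have hchain : mfderiv 𝓘(ℝ, ℝ) 𝓘(ℝ, E4) (e ∘ γ) 0 =
      (mfderiv 𝓘(ℝ, E4) 𝓘(ℝ, E4) e (γ 0)).comp (mfderiv 𝓘(ℝ, ℝ) 𝓘(ℝ, E4) γ 0) :=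
    mfderiv_comp 0 ((contMDiffAt_of_mem_maximalAtlas he.mem_maximalAtlas hq).mdifferentiableAt
      (by simp)) (hγ.mdifferentiableAt (by simp))
  have hdiff : DifferentiableAt ℝ (e ∘ γ) 0 := by
    rw [← mdifferentiableAt_iff_differentiableAt]
    exact ((contMDiffAt_of_mem_maximalAtlas he.mem_maximalAtlas hq).mdifferentiableAt
      (by simp)).comp 0 (hγ.mdifferentiableAt (by simp))
  have key (i : Fin 4) (hi : ∀ t ∈ Metric.ball (0 : ℝ) ε, (e (γ t)) i = (e (γ 0)) i) :
      coordForm e i (γ 0) (mfderiv 𝓘(ℝ, ℝ) 𝓘(ℝ, E4) γ 0 (1 : ℝ)) = 0 := by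
    have e1 : coordForm e i (γ 0) (mfderiv 𝓘(ℝ, ℝ) 𝓘(ℝ, E4) γ 0 (1 : ℝ)) =
        (EuclideanSpace.proj i : E4 →L[ℝ] ℝ) (fderiv ℝ (e ∘ γ) 0 1) := by
      rw [← mfderiv_eq_fderiv, hchain]
      rfl
    have e2 : HasFDerivAt (fun t ↦ (e (γ t)) i)
        ((EuclideanSpace.proj i : E4 →L[ℝ] ℝ).comp (fderiv ℝ (e ∘ γ) 0)) 0 :=
      (EuclideanSpace.proj i : E4 →L[ℝ] ℝ).hasFDerivAt.comp 0 hdiff.hasFDerivAt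
    have e3 : HasFDerivAt (fun t ↦ (e (γ t)) i) (0 : ℝ →L[ℝ] ℝ) 0 :=
      (hasFDerivAt_const ((e (γ 0)) i) (0 : ℝ)).congr_of_eventuallyEq
        (Filter.eventuallyEq_of_mem (Metric.ball_mem_nhds 0 hε) hi)
    rw [e1]
    exact DFunLike.congr_fun (e2.unique e3) (1 : ℝ)
  exact ⟨key 2 fun t ht ↦ (hconst t ht).1, key 3 fun t ht ↦ (hconst t ht).2⟩

/-! ### The metric in a chart -/

/-- The components `g(X, ∂_v)` of `X♭` are smooth in the coordinates of the chart. -/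
theorem contDiffOn_inner_comp_symm (g : LorentzMetric M) {e : OpenPartialHomeomorph M E4}
    (he : e ∈ IsManifold.maximalAtlas 𝓘(ℝ, E4) ∞ M)
    {X : (q : M) → TangentSpace 𝓘(ℝ, E4) q} (hX : IsSmoothVectorField e.source X) (v : E4) :
    ContDiffOn ℝ ∞ (fun y ↦ g.inner (e.symm y) (X (e.symm y))
      (mfderiv 𝓘(ℝ, E4) 𝓘(ℝ, E4) e.symm y v)) e.target := by
  have hs : ContMDiffOn 𝓘(ℝ, E4) 𝓘(ℝ, E4) ∞ e.symm e.target :=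
    contMDiffOn_symm_of_mem_maximalAtlas he
  have h1 := g.contMDiff.comp_contMDiffOn hs
  have h2 := hX.comp hs (fun y hy ↦ e.map_target hy)
  have h3 : ContMDiffOn 𝓘(ℝ, E4) 𝓘(ℝ, E4).tangent ∞ (fun y ↦
      (⟨e.symm y, mfderiv 𝓘(ℝ, E4) 𝓘(ℝ, E4) e.symm y v⟩ : TangentBundle 𝓘(ℝ, E4) M)) e.target := by
    have hT := hs.contMDiffOn_tangentMapWithin (m := ∞) (by simp) e.open_target.uniqueMDiffOn
    have hc : ContMDiffOn 𝓘(ℝ, E4) 𝓘(ℝ, E4).tangent ∞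
        (fun y ↦ (⟨y, (fun _ ↦ v : (z : E4) → TangentSpace 𝓘(ℝ, E4) z) y⟩ :
          TangentBundle 𝓘(ℝ, E4) E4)) e.target :=
      contMDiffOn_vectorSpace_iff_contDiffOn.2 contDiffOn_const
    refine (hT.comp hc (fun y hy ↦ hy)).congr fun y hy ↦ ?_
    simp [tangentMapWithin, mfderivWithin_of_isOpen e.open_target hy]
  have h4 : ContMDiffOn 𝓘(ℝ, E4) (𝓘(ℝ, E4).prod 𝓘(ℝ, ℝ)) ∞ (fun y ↦
      Bundle.TotalSpace.mk' ℝ (E := Bundle.Trivial M ℝ) (e.symm y)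
        (g.inner (e.symm y) (X (e.symm y)) (mfderiv 𝓘(ℝ, E4) 𝓘(ℝ, E4) e.symm y v))) e.target :=
    ContMDiffOn.clm_bundle_apply₂ (F₁ := E4) (F₂ := E4) (F₃ := ℝ) (b := e.symm) h1 h2 h3
  rw [← contMDiffOn_iff_contDiffOn]
  intro y hy
  have h5 := h4 y hy
  rw [Bundle.contMDiffWithinAt_totalSpace] at h5
  exact h5.2

/-- The covector field `X♭` in the coordinates of the chart `e`. -/
def coordFlat (g : LorentzMetric M) (e : OpenPartialHomeomorph M E4)
    (X : (q : M) → TangentSpace 𝓘(ℝ, E4) q) (y : E4) : E4 →L[ℝ] ℝ :=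
  (flat g X (e.symm y)).comp
    (mfderiv 𝓘(ℝ, E4) 𝓘(ℝ, E4) e.symm y : E4 →L[ℝ] TangentSpace 𝓘(ℝ, E4) (e.symm y))

section Metric

variable (g : LorentzMetric M) {X : (q : M) → TangentSpace 𝓘(ℝ, E4) q}

theorem contDiffOn_coordFlat (he : e ∈ IsManifold.maximalAtlas 𝓘(ℝ, E4) ∞ M)
    (hX : IsSmoothVectorField e.source X) : ContDiffOn ℝ ∞ (coordFlat g e X) e.target :=
  contDiffOn_clm_apply.2 fun v ↦ contDiffOn_inner_comp_symm g he hX v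

theorem differentiableAt_coordFlat (he : e ∈ IsManifold.maximalAtlas 𝓘(ℝ, E4) ∞ M)
    (hX : IsSmoothVectorField e.source X) {y : E4} (hy : y ∈ e.target) :
    DifferentiableAt ℝ (coordFlat g e X) y :=
  ((contDiffOn_coordFlat g he hX).contDiffAt (e.open_target.mem_nhds hy)).differentiableAt (by simp)

theorem coordFlat_mfderiv (he : e ∈ IsManifold.maximalAtlas 𝓘(ℝ, E4) ∞ M) {q : M}
    (hq : q ∈ e.source) (v : TangentSpace 𝓘(ℝ, E4) q) :
    coordFlat g e X (e q) (mfderiv 𝓘(ℝ, E4) 𝓘(ℝ, E4) e q v) = g.inner q (X q) v := by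
  have hcongr : ∀ x x' : M, x = x' → ∀ w w' : E4, w = w' →
      g.inner x (X x) w = g.inner x' (X x') w' := by
    rintro x _ rfl w _ rfl; rfl
  exact hcongr _ _ (e.left_inv hq) _ _ (mfderiv_symm_mfderiv he hq v)

theorem coordFlat_single {y : E4} (hy : y ∈ e.target) (i : Fin 4) :
    coordFlat g e X y (EuclideanSpace.single i 1) =
      g.inner (e.symm y) (X (e.symm y)) (coordVec e i (e.symm y)) := by
  have hcongr : ∀ x x' : E4, x = x' → ∀ v : E4, (mfderiv 𝓘(ℝ, E4) 𝓘(ℝ, E4) e.symm x v : E4) =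
      mfderiv 𝓘(ℝ, E4) 𝓘(ℝ, E4) e.symm x' v := by
    rintro x _ rfl v; rfl
  exact congrArg (fun z : E4 ↦ g.inner (e.symm y) (X (e.symm y)) z)
    (hcongr _ _ (e.right_inv hy).symm _)

theorem coordRep_flatForm : coordRep e (flatForm g X) = fun y ↦ wedge ![coordFlat g e X y] := by
  ext y v
  have h (v : E4) : flat g X (e.symm y) (mfderiv 𝓘(ℝ, E4) 𝓘(ℝ, E4) e.symm y v) =
      coordFlat g e X y v := rfl
  exact wedge_one_comp h v

theorem extD_flatForm_apply (he : e ∈ IsManifold.maximalAtlas 𝓘(ℝ, E4) ∞ M)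
    (hX : IsSmoothVectorField e.source X) {q : M} (hq : q ∈ e.source)
    (v w : TangentSpace 𝓘(ℝ, E4) q) :
    extD e (flatForm g X) q ![v, w] =
      fderiv ℝ (coordFlat g e X) (e q) (mfderiv 𝓘(ℝ, E4) 𝓘(ℝ, E4) e q v)
        (mfderiv 𝓘(ℝ, E4) 𝓘(ℝ, E4) e q w) -
      fderiv ℝ (coordFlat g e X) (e q) (mfderiv 𝓘(ℝ, E4) 𝓘(ℝ, E4) e q w)
        (mfderiv 𝓘(ℝ, E4) 𝓘(ℝ, E4) e q v) := by
  rw [extD_apply_two, coordRep_flatForm]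
  exact extDeriv_wedge_one (differentiableAt_coordFlat g he hX (e.map_source hq)) _ _

theorem coordRep_smul_wedge_flat {η : Form M 2} {X Y : (q : M) → TangentSpace 𝓘(ℝ, E4) q} {y : E4}
    {c : ℝ} (h : η (e.symm y) = c • wedge ![flat g X (e.symm y), flat g Y (e.symm y)]) :
    coordRep e η y = c • wedge ![coordFlat g e X y, coordFlat g e Y y] := by
  ext v
  have h1 (X : (q : M) → TangentSpace 𝓘(ℝ, E4) q) (v : E4) :
      flat g X (e.symm y) (mfderiv 𝓘(ℝ, E4) 𝓘(ℝ, E4) e.symm y v) = coordFlat g e X y v := rfl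
  exact (DFunLike.congr_fun h _).trans (smul_wedge_two_comp (h1 X) (h1 Y) c v)

end Metric

section Frame

variable {g : LorentzMetric M} {𝓕 : Foliation M} {s l a n : (q : M) → TangentSpace 𝓘(ℝ, E4) q}

theorem IsAdaptedFrame.isNullTetrad {U : Set M} (h : IsAdaptedFrame g 𝓕 U s l a n) {q : M}
    (hq : q ∈ U) : IsNullTetrad (g.inner q) (s q) (l q) (a q) (n q) where
  symm := g.symm q
  s_s := h.s_s q hq
  a_a := h.a_a q hq
  l_l := h.l_l q hq
  n_n := h.n_n q hq
  n_l := h.n_l q hq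
  n_s := h.n_s q hq
  n_a := h.n_a q hq
  l_s := h.l_s q hq
  l_a := h.l_a q hq
  s_a := h.s_a q hq

theorem IsNullTetrad.inner_coordVecUp (he : e ∈ IsManifold.maximalAtlas 𝓘(ℝ, E4) ∞ M) {q : M}
    (hq : q ∈ e.source) {s l a n : TangentSpace 𝓘(ℝ, E4) q} (h : IsNullTetrad (g.inner q) s l a n)
    (i : Fin 4) (v : TangentSpace 𝓘(ℝ, E4) q) :
    g.inner q (coordVecUp g e i q) v = coordForm e i q v :=
  h.inner_up (isDualPair_coord he hq) i v

theorem IsNullTetrad.inner_sharp_form (he : e ∈ IsManifold.maximalAtlas 𝓘(ℝ, E4) ∞ M) {q : M}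
    (hq : q ∈ e.source) {s l a n : TangentSpace 𝓘(ℝ, E4) q} (h : IsNullTetrad (g.inner q) s l a n)
    (θ : Form M 1) (v : TangentSpace 𝓘(ℝ, E4) q) : g.inner q v (sharp g e θ q) = θ q ![v] :=
  h.inner_sharp (isDualPair_coord he hq) (θ q) v

theorem IsNullTetrad.hodge_eq (he : e ∈ IsManifold.maximalAtlas 𝓘(ℝ, E4) ∞ M) {q : M}
    (hq : q ∈ e.source) {s l a n : TangentSpace 𝓘(ℝ, E4) q} (h : IsNullTetrad (g.inner q) s l a n)
    {F : Form M 2} {φ : ℝ} (hF : F q = φ • wedge ![g.inner q a, g.inner q l]) :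
    hodge g e (k := 2) (m := 2) rfl F q =
      (-(SignType.sign (Matrix.of fun r i ↦
        g.inner q (![s, l, a, n] r) (coordVec e i q)).det : ℝ) * φ) •
        wedge ![g.inner q s, g.inner q l] :=
  h.hodge_two_eq (finrank_tangentSpace q) (isDualPair_coord he hq) (F q) φ hF

theorem IsNullTetrad.hodge_apply_eq_zero_iff (he : e ∈ IsManifold.maximalAtlas 𝓘(ℝ, E4) ∞ M)
    {q : M} (hq : q ∈ e.source) {s l a n : TangentSpace 𝓘(ℝ, E4) q}
    (h : IsNullTetrad (g.inner q) s l a n) (η : Form M 3) :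
    (hodge g e (k := 3) (m := 1) rfl η q ![a] = 0 ↔ η q ![s, l, n] = 0) ∧
    (hodge g e (k := 3) (m := 1) rfl η q ![l] = 0 ↔ η q ![s, l, a] = 0) :=
  h.hodge_three_eq_zero_iff (finrank_tangentSpace q) (isDualPair_coord he hq) (η q) rfl

end Frame

/-! ### Leaf functions and solutions -/

namespace IsAdaptedFrame

variable (h : IsAdaptedFrame g 𝓕 e.source s l a n) (he : IsFlatChart 𝓕.leaves e)
include h he

theorem coordForm_apply {q : M} (hq : q ∈ e.source) :
    (coordForm e 2 q (s q) = 0 ∧ coordForm e 3 q (s q) = 0) ∧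
    (coordForm e 2 q (l q) = 0 ∧ coordForm e 3 q (l q) = 0) := by
  refine ⟨he.coordForm_eq_zero hq ?_, he.coordForm_eq_zero hq ?_⟩ <;> rw [h.tangent_eq q hq] <;>
    exact Submodule.subset_span (by simp)

theorem mem_tangent_iff {q : M} (hq : q ∈ e.source) (v : TangentSpace 𝓘(ℝ, E4) q) :
    v ∈ 𝓕.tangent q ↔ coordForm e 2 q v = 0 ∧ coordForm e 3 q v = 0 := by
  obtain ⟨⟨h1, h2⟩, h3, h4⟩ := h.coordForm_apply he hq
  rw [h.tangent_eq q hq]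
  exact (h.isNullTetrad hq).mem_span_iff_of_annihilated (finrank_tangentSpace q)
    (isDualPair_coord he.mem_maximalAtlas hq) h1 h3 h2 h4 v

theorem kappa_ne_zero {q : M} (hq : q ∈ e.source) : kappa g e l a q ≠ 0 := by
  obtain ⟨⟨h1, h2⟩, h3, h4⟩ := h.coordForm_apply he hq
  exact inv_ne_zero ((h.isNullTetrad hq).conormal_wedge_eq (finrank_tangentSpace q)
    (isDualPair_coord he.mem_maximalAtlas hq) h1 h3 h2 h4).1

/-- `(u κ) α ∧ l♭ = u dx³ ∧ dx⁴` -/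
theorem leafField_eq {q : M} (hq : q ∈ e.source) :
    leafField g e l a u q = u q • wedge ![coordForm e 2 q, coordForm e 3 q] := by
  obtain ⟨⟨h1, h2⟩, h3, h4⟩ := h.coordForm_apply he hq
  have hk := ((h.isNullTetrad hq).conormal_wedge_eq (finrank_tangentSpace q)
    (isDualPair_coord he.mem_maximalAtlas hq) h1 h3 h2 h4).2
  ext v
  have h5 := hk (v 0) (v 1)
  rw [leafField, ContinuousAlternatingMap.smul_apply, ContinuousAlternatingMap.smul_apply,
    wedge_two_apply, wedge_two_apply, smul_eq_mul, mul_assoc]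
  exact congrArg (u q * ·) h5

end IsAdaptedFrame

namespace IsAdaptedFrame

variable (h : IsAdaptedFrame g 𝓕 e.source s l a n)
include h

theorem normSq_eq_zero (he : IsFlatChart 𝓕.leaves e)
    (hF : ∀ q ∈ e.source, F q = leafField g e l a u q) {q : M} (hq : q ∈ e.source) :
    normSq g e F q = 0 :=
  (h.isNullTetrad hq).sum_mul_self_eq_zero (finrank_tangentSpace q)
    (isDualPair_coord he.mem_maximalAtlas hq)
    ((h.isNullTetrad hq).inner_coordVecUp he.mem_maximalAtlas hq) (F q) _ (hF q hq)

/-- The determinant of the components of the covectors of the frame has a locally constant sign. -/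
theorem eventually_sign_det (he : IsFlatChart 𝓕.leaves e) {q : M} (hq : q ∈ e.source) :
    ∃ c : ℝ, c ≠ 0 ∧ ∀ᶠ y in 𝓝 (e q), y ∈ e.target ∧ -(SignType.sign (Matrix.of fun r i ↦
      g.inner (e.symm y) ((![s (e.symm y), l (e.symm y), a (e.symm y), n (e.symm y)] :
        Fin 4 → TangentSpace 𝓘(ℝ, E4) (e.symm y)) r) (coordVec e i (e.symm y))).det : ℝ) = c := by
  have hm := he.mem_maximalAtlas
  set Δ : E4 → ℝ := fun y ↦
    (Matrix.of fun r i ↦ (![coordFlat g e s y, coordFlat g e l y, coordFlat g e a y,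
      coordFlat g e n y] : Fin 4 → (E4 →L[ℝ] ℝ)) r (EuclideanSpace.single i 1)).det with hΔ
  have h1 : ∀ y ∈ e.target, (Matrix.of fun r i ↦
      g.inner (e.symm y) ((![s (e.symm y), l (e.symm y), a (e.symm y), n (e.symm y)] :
        Fin 4 → TangentSpace 𝓘(ℝ, E4) (e.symm y)) r) (coordVec e i (e.symm y))).det = Δ y := by
    intro y hy
    rw [hΔ]
    congr 1
    ext r i
    fin_cases r <;> exact (coordFlat_single g hy i).symm
  have h2 : Δ (e q) ≠ 0 := by
    rw [← h1 _ (e.map_source hq)]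
    exact (h.isNullTetrad (e.map_target (e.map_source hq))).det_flat_ne_zero
      (isDualPair_coord hm (e.map_target (e.map_source hq)))
  have h3 : ContinuousAt Δ (e q) := by
    refine (Continuous.matrix_det continuous_id).continuousAt.comp ?_
    refine continuousAt_pi.2 fun r ↦ continuousAt_pi.2 fun i ↦ ?_
    have hc (X) (hX : IsSmoothVectorField e.source X) :
        ContinuousAt (fun y ↦ coordFlat g e X y (EuclideanSpace.single i 1)) (e q) :=
      (differentiableAt_coordFlat g hm hX (e.map_source hq)).continuousAt.clm_apply
        continuousAt_const
    fin_cases r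
    exacts [hc s h.smooth_s, hc l h.smooth_l, hc a h.smooth_a, hc n h.smooth_n]
  have h4 : ∀ᶠ y in 𝓝 (e q), SignType.sign (Δ y) = SignType.sign (Δ (e q)) :=
    ((continuousAt_sign_of_ne_zero h2).comp h3).eventually_mem
      ((isOpen_discrete {SignType.sign (Δ (e q))}).mem_nhds rfl)
  refine ⟨-(SignType.sign (Δ (e q)) : ℝ), ?_, ?_⟩
  · rcases h2.lt_or_gt with h0 | h0 <;> simp [h0]
  · filter_upwards [h4, e.open_target.mem_nhds (e.map_source hq)] with y hy hyt
    exact ⟨hyt, by rw [h1 y hyt, hy]⟩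

theorem differentiableAt_mul_kappa (he : IsFlatChart 𝓕.leaves e) (hu : IsLeafFunction e u) {y : E4}
    (hy : y ∈ e.target) :
    DifferentiableAt ℝ (fun y ↦ u (e.symm y) * kappa g e l a (e.symm y)) y := by
  have hm := he.mem_maximalAtlas
  refine (hu.differentiableAt hm hy).mul ?_
  have h1 : (fun y ↦ kappa g e l a (e.symm y)) =ᶠ[𝓝 y] fun y ↦
      (coordFlat g e a y (EuclideanSpace.single 2 1) * coordFlat g e l y (EuclideanSpace.single 3 1) -
        coordFlat g e a y (EuclideanSpace.single 3 1) *
          coordFlat g e l y (EuclideanSpace.single 2 1))⁻¹ := by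
    filter_upwards [e.open_target.mem_nhds hy] with z hz
    rw [coordFlat_single g hz, coordFlat_single g hz, coordFlat_single g hz, coordFlat_single g hz]
    rfl
  have h2 := h.kappa_ne_zero he (e.map_target hy)
  have h3 := h1.eq_of_nhds
  have hd (X) (hX : IsSmoothVectorField e.source X) (v : E4) :
      DifferentiableAt ℝ (fun y ↦ coordFlat g e X y v) y :=
    (differentiableAt_coordFlat g hm hX hy).clm_apply (differentiableAt_const _)
  refine DifferentiableAt.congr_of_eventuallyEq (DifferentiableAt.inv ?_ ?_) h1
  · exact ((hd a h.smooth_a _).mul (hd l h.smooth_l _)).sub ((hd a h.smooth_a _).mul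
      (hd l h.smooth_l _))
  · intro h0
    rw [h0, inv_zero] at h3
    exact h2 h3

/-- At a point where `F = (u κ) α ∧ l♭` does not vanish, `F` is force-free if and only if the
frame satisfies the conditions there. -/
theorem forceFree_iff (he : IsFlatChart 𝓕.leaves e) (hu : IsLeafFunction e u)
    (hF : ∀ q ∈ e.source, F q = leafField g e l a u q) {q : M} (hq : q ∈ e.source)
    (huq : u q ≠ 0) :
    (∀ w, F q ![sharp g e (current g e F) q, w] = 0) ↔
      extD e (flatForm g a) q ![l q, a q] = extD e (flatForm g s) q ![l q, s q] ∧
      extD e (flatForm g l) q ![l q, a q] = 0 := by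
  have hm := he.mem_maximalAtlas
  have ht := h.isNullTetrad hq
  have hy := e.map_source hq
  obtain ⟨c, hc, hev⟩ := h.eventually_sign_det he hq
  set φ : E4 → ℝ := fun y ↦ u (e.symm y) * kappa g e l a (e.symm y) with hφ
  have hφq : φ (e q) = u q * kappa g e l a q := by simp [hφ, hq]
  have hφ0 : u q * kappa g e l a q ≠ 0 := mul_ne_zero huq (h.kappa_ne_zero he hq)
  have hφd : DifferentiableAt ℝ φ (e q) := h.differentiableAt_mul_kappa he hu hy
  have hds := differentiableAt_coordFlat g hm h.smooth_s hy
  have hdl := differentiableAt_coordFlat g hm h.smooth_l hy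
  have hda := differentiableAt_coordFlat g hm h.smooth_a hy
  -- the coordinate expressions of `F` and `*F`
  have hF1 : coordRep e F =ᶠ[𝓝 (e q)] fun y ↦
      φ y • wedge ![coordFlat g e a y, coordFlat g e l y] := by
    filter_upwards [hev] with y hy
    exact coordRep_smul_wedge_flat g (hF _ (e.map_target hy.1))
  have hF2 : coordRep e (hodge g e (k := 2) (m := 2) rfl F) =ᶠ[𝓝 (e q)] c • fun y ↦
      φ y • wedge ![coordFlat g e s y, coordFlat g e l y] := by
    filter_upwards [hev] with y hy
    have h1 := (h.isNullTetrad (e.map_target hy.1)).hodge_eq hm (e.map_target hy.1)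
      (hF _ (e.map_target hy.1))
    rw [hy.2] at h1
    rw [Pi.smul_apply, smul_smul]
    exact coordRep_smul_wedge_flat g h1
  -- the current is in the kernel of `F` if and only if two components of `d * F` vanish
  have hcur := ht.hodge_apply_eq_zero_iff hm hq (extD e (hodge g e (k := 2) (m := 2) rfl F))
  have hker : (∀ w, F q ![sharp g e (current g e F) q, w] = 0) ↔
      extD e (hodge g e (k := 2) (m := 2) rfl F) q ![s q, l q, n q] = 0 ∧
      extD e (hodge g e (k := 2) (m := 2) rfl F) q ![s q, l q, a q] = 0 := by
    rw [← hcur.1, ← hcur.2, hF q hq]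
    refine (ht.smul_wedge_apply_eq_zero_iff hφ0 _).trans ?_
    rw [ht.inner_sharp_form hm hq, ht.inner_sharp_form hm hq, current]
  -- the frame at `q` in the coordinates of the chart, and the components of its covectors
  obtain ⟨S, hS⟩ : ∃ z : E4, z = mfderiv 𝓘(ℝ, E4) 𝓘(ℝ, E4) e q (s q) := ⟨_, rfl⟩
  obtain ⟨L, hL⟩ : ∃ z : E4, z = mfderiv 𝓘(ℝ, E4) 𝓘(ℝ, E4) e q (l q) := ⟨_, rfl⟩
  obtain ⟨A, hA⟩ : ∃ z : E4, z = mfderiv 𝓘(ℝ, E4) 𝓘(ℝ, E4) e q (a q) := ⟨_, rfl⟩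
  obtain ⟨N, hN⟩ : ∃ z : E4, z = mfderiv 𝓘(ℝ, E4) 𝓘(ℝ, E4) e q (n q) := ⟨_, rfl⟩
  have hval (X : (q : M) → TangentSpace 𝓘(ℝ, E4) q) :
      coordFlat g e X (e q) S = g.inner q (X q) (s q) ∧
      coordFlat g e X (e q) L = g.inner q (X q) (l q) ∧
      coordFlat g e X (e q) A = g.inner q (X q) (a q) ∧
      coordFlat g e X (e q) N = g.inner q (X q) (n q) := by
    rw [hS, hL, hA, hN]
    exact ⟨coordFlat_mfderiv g hm hq _, coordFlat_mfderiv g hm hq _, coordFlat_mfderiv g hm hq _,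
      coordFlat_mfderiv g hm hq _⟩
  have hd (X) (hX : IsSmoothVectorField e.source X) (v w : TangentSpace 𝓘(ℝ, E4) q) (y z : E4)
      (hy : y = mfderiv 𝓘(ℝ, E4) 𝓘(ℝ, E4) e q v) (hz : z = mfderiv 𝓘(ℝ, E4) 𝓘(ℝ, E4) e q w) :
      extD e (flatForm g X) q ![v, w] = fderiv ℝ (coordFlat g e X) (e q) y z -
        fderiv ℝ (coordFlat g e X) (e q) z y := by
    rw [hy, hz]
    exact extD_flatForm_apply g hm hX hq v w
  have hclosed : extDeriv (coordRep e F) (e q) ![L, A, N] = 0 :=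
    DFunLike.congr_fun (hu.extDeriv_coordRep hm
      (fun q hq ↦ (hF q hq).trans (h.leafField_eq he hq)) hy) _
  rw [hF1.extDeriv_eq, extDeriv_smul_wedge_two hφd hda hdl] at hclosed
  have hstar (v : TangentSpace 𝓘(ℝ, E4) q) (z : E4)
      (hz : z = mfderiv 𝓘(ℝ, E4) 𝓘(ℝ, E4) e q v) :
      extD e (hodge g e (k := 2) (m := 2) rfl F) q ![s q, l q, v] =
        c * extDeriv (fun y ↦ φ y • wedge ![coordFlat g e s y, coordFlat g e l y]) (e q)
          ![S, L, z] := by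
    rw [extD_apply_three, hF2.extDeriv_eq, extDeriv_smul, hS, hL, hz]
    rfl
  rw [hker, hstar _ N hN, hstar _ A hA, extDeriv_smul_wedge_two hφd hds hdl,
    extDeriv_smul_wedge_two hφd hds hdl, hd a h.smooth_a _ _ L A hL hA,
    hd s h.smooth_s _ _ L S hL hS, hd l h.smooth_l _ _ L A hL hA]
  simp only [(hval _).1, (hval _).2.1, (hval _).2.2.1, (hval _).2.2.2, ht.s_s, ht.a_a, ht.l_l,
    ht.l_s, ht.l_a, ht.s_a, ht.symm (a q) (l q), ht.symm (s q) (l q),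
    ht.symm (s q) (n q), ht.n_s, ht.symm (l q) (n q), ht.n_l, ht.symm (a q) (n q), ht.n_a, hφq,
    mul_eq_zero, hc, false_or] at hclosed ⊢
  generalize u q * kappa g e l a q = ψ at *
  constructor
  · rintro ⟨h1, h2⟩
    refine ⟨mul_left_cancel₀ hφ0 ?_, mul_left_cancel₀ hφ0 ?_⟩
    · linear_combination -hclosed - h1
    · linear_combination -h2
  · rintro ⟨h1, h2⟩
    constructor
    · linear_combination -hclosed - ψ * h1
    · linear_combination -ψ * h2

end IsAdaptedFrame

theorem leafField_eq_zero {q : M} (hq : u q = 0) : leafField g e l a u q = 0 := by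
  rw [leafField, hq, zero_mul, zero_smul]

namespace IsAdaptedFrame

variable (h : IsAdaptedFrame g 𝓕 e.source s l a n) (he : IsFlatChart 𝓕.leaves e)
include h he

theorem kernel_eq_iff {q : M} (hq : q ∈ e.source) (hF : F q = leafField g e l a u q) :
    kernel F q = 𝓕.tangent q ↔ u q ≠ 0 := by
  have ht := h.isNullTetrad hq
  rw [h.tangent_eq q hq]
  constructor
  · intro H h0
    have h1 : n q ∈ kernel F q := fun w ↦ by
      rw [hF, leafField_eq_zero h0]
      rfl
    rw [H] at h1
    have h2 := ((ht.mem_span_iff (finrank_tangentSpace q) (n q)).1 h1).2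
    rw [ht.symm, ht.n_l] at h2
    norm_num at h2
  · intro h0
    ext v
    rw [kernel, Set.mem_ofPred_eq, hF]
    exact (ht.smul_wedge_apply_eq_zero_iff (mul_ne_zero h0 (h.kappa_ne_zero he hq)) v).trans
      (ht.mem_span_iff (finrank_tangentSpace q) v).symm

theorem isNullForceFree (hC : FrameCondition g e s l a) (hu : IsLeafFunction e u)
    (hF : ∀ q ∈ e.source, F q = leafField g e l a u q) : IsNullForceFree g e F := by
  have hF' : ∀ q ∈ e.source, F q = u q • wedge ![coordForm e 2 q, coordForm e 3 q] :=
    fun q hq ↦ (hF q hq).trans (h.leafField_eq he hq)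
  refine ⟨hu.isSmoothForm he.mem_maximalAtlas hF', fun q hq ↦ ?_, fun q hq ↦ ?_,
    fun q hq ↦ h.normSq_eq_zero he hF hq⟩
  · ext v
    rw [extD_apply, hu.extDeriv_coordRep he.mem_maximalAtlas hF' (e.map_source hq)]
    rfl
  · by_cases h0 : u q = 0
    · intro w
      rw [hF q hq, leafField_eq_zero h0]
      rfl
    · exact (h.forceFree_iff he hu hF hq h0).2 (hC q hq)

theorem isLeafSolution_iff (hu : IsLeafFunction e u) (h0 : ∀ q ∈ e.source, u q ≠ 0)
    (hF : ∀ q ∈ e.source, F q = leafField g e l a u q) :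
    IsLeafSolution g 𝓕 e F ↔ FrameCondition g e s l a :=
  ⟨fun H q hq ↦ (h.forceFree_iff he hu hF hq (h0 q hq)).1 (H.isNullForceFree.forceFree q hq),
    fun hC ↦ ⟨h.isNullForceFree he hC hu hF,
      fun q hq ↦ (h.kernel_eq_iff he hq (hF q hq)).2 (h0 q hq)⟩⟩

/-- A form whose kernel is the tangent space of the leaves is a multiple of `dx³ ∧ dx⁴`, and if it
is closed, then the factor is a leaf function. -/
theorem exists_isLeafFunction (H : IsLeafSolution g 𝓕 e F) :
    ∃ u : M → ℝ, IsLeafFunction e u ∧ (∀ q ∈ e.source, u q ≠ 0) ∧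
      ∀ q ∈ e.source, F q = leafField g e l a u q := by
  have hF : ∀ q ∈ e.source, F q = F q ![coordVec e 2 q, coordVec e 3 q] •
      wedge ![coordForm e 2 q, coordForm e 3 q] := by
    intro q hq
    have hd := isDualPair_coord he.mem_maximalAtlas hq
    have hmem (i : Fin 4) (h2 : 2 ≠ i) (h3 : 3 ≠ i) : coordVec e i q ∈ kernel F q := by
      rw [H.kernel_eq q hq, h.mem_tangent_iff he hq]
      exact ⟨(hd.dual 2 i).trans (if_neg h2), (hd.dual 3 i).trans (if_neg h3)⟩
    exact hd.two_form_eq (hmem 0 (by decide) (by decide)) (hmem 1 (by decide) (by decide))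
  have hF' : ∀ q ∈ e.source, F q =
      leafField g e l a (fun q ↦ F q ![coordVec e 2 q, coordVec e 3 q]) q :=
    fun q hq ↦ (hF q hq).trans (h.leafField_eq (u := fun q ↦ F q ![coordVec e 2 q, coordVec e 3 q]) he hq).symm
  exact ⟨_, isLeafFunction_of_closed he hF H.isNullForceFree.smooth H.isNullForceFree.closed,
    fun q hq ↦ (h.kernel_eq_iff he hq (hF' q hq)).1 (H.kernel_eq q hq), hF'⟩

end IsAdaptedFrame

end NullFF

end

theorem mainTheorem1 {M : Type*} [TopologicalSpace M] [T2Space M] [SecondCountableTopology M]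
    [ChartedSpace NullFF.E4 M] [IsManifold 𝓘(ℝ, NullFF.E4) ∞ M]
    (g : NullFF.LorentzMetric M) (𝓕 : NullFF.Foliation M) (h𝓕 : 𝓕.IsNull g)
    (p : M) (e : OpenPartialHomeomorph M NullFF.E4) (he : 𝓕.IsAdaptedChart p e)
    (s l a n : (q : M) → TangentSpace 𝓘(ℝ, NullFF.E4) q)
    (hframe : NullFF.IsAdaptedFrame g 𝓕 e.source s l a n) :
    -- each nowhere vanishing leaf function `u` gives a solution if and only if the conditions hold
    (∀ u : M → ℝ, NullFF.IsLeafFunction e u → (∀ q ∈ e.source, u q ≠ 0) →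
      (NullFF.IsLeafSolution g 𝓕 e (NullFF.leafField g e l a u) ↔
        NullFF.FrameCondition g e s l a)) ∧
    -- arbitrary leaf functions `u`, which may have zeros
    (NullFF.FrameCondition g e s l a → ∀ u : M → ℝ, NullFF.IsLeafFunction e u →
      NullFF.IsNullForceFree g e (NullFF.leafField g e l a u) ∧
      ∀ q ∈ e.source, NullFF.kernel (NullFF.leafField g e l a u) q = 𝓕.tangent q ↔ u q ≠ 0) ∧
    -- the fields `(u κ) α ∧ l♭` are exactly the solutions if and only if the conditions hold
    ((∀ F : NullFF.Form M 2, NullFF.IsLeafSolution g 𝓕 e F ↔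
        ∃ u : M → ℝ, NullFF.IsLeafFunction e u ∧ (∀ q ∈ e.source, u q ≠ 0) ∧
          ∀ q ∈ e.source, F q = NullFF.leafField g e l a u q) ↔
      NullFF.FrameCondition g e s l a) := by
  have hc := he.isFlatChart
  refine ⟨fun u hu h0 ↦ hframe.isLeafSolution_iff hc hu h0 fun _ _ ↦ rfl, fun hC u hu ↦
    ⟨hframe.isNullForceFree hc hC hu fun _ _ ↦ rfl, fun q hq ↦ hframe.kernel_eq_iff hc hq rfl⟩,
    fun H ↦ ?_, fun hC F ↦ ⟨hframe.exists_isLeafFunction hc, ?_⟩⟩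
  · -- the constant function `1` is a nowhere vanishing leaf function
    exact (hframe.isLeafSolution_iff hc NullFF.isLeafFunction_one (fun _ _ ↦ one_ne_zero)
      fun _ _ ↦ rfl).1 ((H _).2 ⟨_, NullFF.isLeafFunction_one, fun _ _ ↦ one_ne_zero,
        fun _ _ ↦ rfl⟩)
  · rintro ⟨u, hu, h0, hF⟩
    exact (hframe.isLeafSolution_iff hc hu h0 hF).2 hC
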